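/- For an irrational real number $\xi$, let $$\ell(\xi):=\limsup_{|p|,q\to\infty}\frac{1}{|q(q\xi-p)|}\in[0,\infty]$$ be its best constant of Diophantine approximation, where $p$ runs over the integers and $q$ over the positive integers, and let $$L:=\{\ell(\xi):\xi\in\mathbb{R}\setminus\mathbb{Q},\ \ell(\xi)<\infty\}\subset\mathbb{R}$$ be the Lagrange spectrum. Let $HD(X)$ denote the Hausdorff dimension of a set $X\subset\mathbb{R}$, and put $d(t):=HD(L\cap(-\infty,t))\in[0,1]$ for $t\in\mathbb{R}$. **Corollary (Moreira).** The function $d:\mathbb{R}\to[0,1]$ is not $\alpha$-Hölder continuous for any $\alpha>0$; that is, for every real $\alpha>0$ there is no constant $C>0$ such that $|d(t)-d(t')|\le C|t-t'|^{\alpha}$ for all $t,t'\in\mathbb{R}$. -/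

import Mathlib

open Filter Set
open scoped NNReal

/-- The best constant of Diophantine approximation of `α`: the limit superior of
`1 / |q (q α - p)|` over integers `p` and positive integers `q` as `|p| → ∞` and `q → ∞`
(on `ℤ` the filter `cofinite` expresses `|p| → ∞`). It is computed in the extended reals, so that
it may be `+∞`. -/
noncomputable def bestConstant (α : ℝ) : EReal :=
  limsup (fun x : ℤ × ℕ => ((1 / |(x.2 : ℝ) * ((x.2 : ℝ) * α - (x.1 : ℝ))| : ℝ) : EReal))
    (cofinite ×ˢ atTop)

/-- The Lagrange spectrum: the finite best constants of Diophantine approximation of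
irrational numbers. -/
def lagrangeSpectrum : Set ℝ :=
  {x : ℝ | ∃ α : ℝ, Irrational α ∧ bestConstant α = (x : EReal)}

/-- The Hausdorff dimension of a set of real numbers is at most one; in particular it is finite, so
that reading it as a real number loses nothing. -/
theorem dimH_real_le_one (s : Set ℝ) : dimH s ≤ 1 :=
  (dimH_mono (subset_univ s)).trans Real.dimH_univ.le

/-- The function `t ↦ HD(L ∩ (-∞, t))`, where `L` is the Lagrange spectrum. -/
noncomputable def lagrangeDim (t : ℝ) : ℝ :=
  (dimH (lagrangeSpectrum ∩ Iio t)).toReal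

/-! The function `lagrangeDim` vanishes at 3, but at 3 + 4⁻ⁿ it is at least of order 1/n. A Hölder
bound of exponent α would give 1/n ≲ 4^(-αn), which fails for large n.

Vanishing at 3 (Markov). Fractions that are not multiples of convergents contribute at most 2 to the
best constant (`IsCF.value_le`), so only the values d k + [0; d (k+1), …] + [0; d (k-1), …] matter.
If these stay below some B < 3, the digits are eventually 1 or 2 and neither is isolated. Where 22
meets 11 the value is 3 plus a difference comparing the expansions on the two sides. Hence the two
sides must differ within a bounded distance, in a prescribed order (`IsCF.boundaryCondition`).
Unless the digits become constant, their runs then have even length, and halving them gives a word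
with Markov's property. In such a word at most one letter is doubled, and rewriting it in blocks a,
ab gives a word of the same type with a smaller bound. By induction the digits are eventually
periodic, so the spectrum below 3 is countable.

Growth above 3. Runs of 2k digits 1 separated by 22 give values near 3, because [0; 1, 1, …] = σ
with σ² + σ = 1 and 2 + σ + 1/(2 + σ) = 3. One run of parameter n among runs of parameter at least
2n + 3 produces a value strictly dominating all those not adjacent to such a run
(`pairValue_bounds`). Repeating it between longer and longer mirrored copies of a fixed sequence X
makes this value the limit superior (`pairValue_mem_lagrangeSpectrum`). Choosing each X l in {N, N +
1} by the binary digits of y ∈ [0, 1) embeds [0, 1) in the spectrum with a Hölder inverse of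
exponent log 2 / ((2n + 7) log 9), which bounds the dimension below (`le_lagrangeDim`). -/

/-! ### Continued fractions, convergents and the best constant. -/

/-- `IsCF ξ a d r` says that `ξ = a + r 0` has the regular continued fraction
`[a; d 0, d 1, …]`, where `r k = [0; d k, d (k + 1), …]`. -/
structure IsCF (ξ : ℝ) (a : ℤ) (d : ℕ → ℕ) (r : ℕ → ℝ) : Prop where
  base : ξ = a + r 0
  pos : ∀ k, 0 < r k
  lt_one : ∀ k, r k < 1
  step : ∀ k, 1 / r k = d k + r (k + 1)

/-- The finite continued fraction `[0; d (k - 1), …, d 0]`. -/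
noncomputable def cfLeft (d : ℕ → ℕ) : ℕ → ℝ
  | 0 => 0
  | k + 1 => 1 / (d k + cfLeft d k)

/-- Denominators of the convergents, starting with `0, 1`. -/
def cfDen (d : ℕ → ℕ) : ℕ → ℤ
  | 0 => 0
  | 1 => 1
  | k + 2 => d k * cfDen d (k + 1) + cfDen d k

/-- Numerators of the convergents, starting with `1, a`. -/
def cfNum (a : ℤ) (d : ℕ → ℕ) : ℕ → ℤ
  | 0 => 1
  | 1 => a
  | k + 2 => d k * cfNum a d (k + 1) + cfNum a d k

/-- The approximation constant contributed by the `k`-th convergent. -/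
noncomputable def cfValue (d : ℕ → ℕ) (r : ℕ → ℝ) (k : ℕ) : ℝ :=
  d k + r (k + 1) + cfLeft d k

theorem cfDen_det (a : ℤ) (d : ℕ → ℕ) (k : ℕ) :
    cfDen d (k + 1) * cfNum a d k - cfDen d k * cfNum a d (k + 1) = (-1) ^ k := by
  induction k with
  | zero => simp [cfDen, cfNum]
  | succ k ih =>
    simp only [cfDen, cfNum]
    rw [pow_succ, ← ih]
    ring

namespace IsCF

variable {ξ : ℝ} {a : ℤ} {d : ℕ → ℕ} {r : ℕ → ℝ}

theorem one_le (h : IsCF ξ a d r) (k : ℕ) : 1 ≤ d k := by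
  have h1 := h.step k
  have h2 : 1 < 1 / r k := by
    rw [lt_div_iff₀ (h.pos k)]; linarith [h.lt_one k]
  have h3 : (0 : ℝ) < d k := by linarith [h.lt_one (k + 1)]
  exact_mod_cast h3

theorem den_nonneg (h : IsCF ξ a d r) (k : ℕ) : 0 ≤ cfDen d k ∧ 0 < cfDen d (k + 1) := by
  induction k with
  | zero => simp [cfDen]
  | succ k ih =>
    refine ⟨ih.2.le, ?_⟩
    simp only [cfDen]
    have h1 : (0 : ℤ) < d k := by exact_mod_cast h.one_le k
    have := mul_pos h1 ih.2
    linarith [ih.1]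

theorem den_pos (h : IsCF ξ a d r) (k : ℕ) : 0 < cfDen d (k + 1) := (h.den_nonneg k).2

theorem den_mono (h : IsCF ξ a d r) (k : ℕ) :
    cfDen d (k + 1) + cfDen d k ≤ cfDen d (k + 2) := by
  have h1 : (1 : ℤ) ≤ d k := by exact_mod_cast h.one_le k
  have := mul_le_mul_of_nonneg_right h1 (h.den_pos k).le
  simp only [cfDen]
  linarith

theorem den_ge (h : IsCF ξ a d r) (k : ℕ) : (k : ℤ) ≤ cfDen d (k + 1) := by
  induction k with
  | zero => simp [cfDen]
  | succ k ih =>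
    rcases k with _ | k
    · have := h.den_pos 1
      push_cast; linarith
    · have h1 := h.den_mono (k + 1)
      have h2 := h.den_pos k
      push_cast at ih ⊢
      linarith

theorem cfLeft_eq (h : IsCF ξ a d r) (k : ℕ) :
    cfLeft d k = (cfDen d k : ℝ) / cfDen d (k + 1) := by
  induction k with
  | zero => simp [cfLeft, cfDen]
  | succ k ih =>
    have h1 : (0 : ℝ) < cfDen d (k + 1) := by exact_mod_cast h.den_pos k
    have h2 : (0 : ℝ) < cfDen d (k + 2) := by exact_mod_cast h.den_pos (k + 1)
    simp only [cfLeft, ih]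
    have : (cfDen d (k + 2) : ℝ) = d k * cfDen d (k + 1) + cfDen d k := by
      simp [cfDen]
    rw [this] at h2 ⊢
    have h3 : (d k : ℝ) + cfDen d k / cfDen d (k + 1) =
      (d k * cfDen d (k + 1) + cfDen d k) / cfDen d (k + 1) := by field_simp
    rw [h3, one_div_div]

theorem cfLeft_nonneg (h : IsCF ξ a d r) (k : ℕ) : 0 ≤ cfLeft d k := by
  rw [h.cfLeft_eq]
  have h1 : (0 : ℝ) < cfDen d (k + 1) := by exact_mod_cast h.den_pos k
  have h2 : (0 : ℝ) ≤ cfDen d k := by exact_mod_cast (h.den_nonneg k).1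
  positivity

theorem cfLeft_le_one (h : IsCF ξ a d r) (k : ℕ) : cfLeft d k ≤ 1 := by
  rcases k with _ | k
  · simp [cfLeft]
  · simp only [cfLeft]
    have h1 : (1 : ℝ) ≤ d k := by exact_mod_cast h.one_le k
    rw [div_le_one (by linarith [h.cfLeft_nonneg k])]
    linarith [h.cfLeft_nonneg k]

theorem diff_step (h : IsCF ξ a d r) (k : ℕ) :
    (cfDen d (k + 1) * ξ - cfNum a d (k + 1) : ℝ) =
      -r k * (cfDen d k * ξ - cfNum a d k) := by
  induction k with
  | zero => simp [cfDen, cfNum, h.base]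
  | succ k ih =>
    have h1 := h.step k
    have h2 := h.pos k
    have h3 : (1 : ℝ) = (d k + r (k + 1)) * r k := by
      rw [← h1]; field_simp
    have e1 : (cfDen d (k + 2) : ℝ) = d k * cfDen d (k + 1) + cfDen d k := by simp [cfDen]
    have e2 : (cfNum a d (k + 2) : ℝ) = d k * cfNum a d (k + 1) + cfNum a d k := by simp [cfNum]
    rw [e1, e2]
    linear_combination (d k + r (k + 1)) * ih +
      (cfDen d k * ξ - cfNum a d k) * h3

theorem diff_ne_zero (h : IsCF ξ a d r) (k : ℕ) : (cfDen d k * ξ - cfNum a d k : ℝ) ≠ 0 := by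
  induction k with
  | zero => simp [cfDen, cfNum]
  | succ k ih =>
    rw [h.diff_step]
    exact mul_ne_zero (neg_ne_zero.2 (h.pos k).ne') ih

theorem cfValue_pos (h : IsCF ξ a d r) (k : ℕ) : 0 < cfValue d r k := by
  have h2 : (0 : ℝ) ≤ d k := by positivity
  have := h.pos (k + 1)
  have := h.cfLeft_nonneg k
  rw [cfValue]; linarith

/-- Dividing the determinant identity for consecutive convergents by the recursion `diff_step`
leaves 1 / r k + cfDen k / cfDen (k + 1), and this is the value at k. -/
theorem diff_mul (h : IsCF ξ a d r) (k : ℕ) :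
    |(cfDen d (k + 1) : ℝ) * (cfDen d (k + 1) * ξ - cfNum a d (k + 1))| * cfValue d r k = 1 := by
  have hp : (0 : ℝ) < cfDen d (k + 1) := by exact_mod_cast h.den_pos k
  have hv : cfValue d r k = (d k + r (k + 1)) + cfDen d k / cfDen d (k + 1) := by
    rw [cfValue, h.cfLeft_eq]
  rw [← abs_of_pos (h.cfValue_pos k), ← abs_mul]
  have hdet : (cfDen d (k + 1) * cfNum a d k - cfDen d k * cfNum a d (k + 1) : ℝ) = (-1) ^ k := by
    exact_mod_cast cfDen_det a d k
  have h3 : (1 : ℝ) = (d k + r (k + 1)) * r k := by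
    rw [← h.step k]; field_simp [(h.pos k).ne']
  have h4 := h.diff_step k
  suffices hh : (cfDen d (k + 1) : ℝ) * (cfDen d (k + 1) * ξ - cfNum a d (k + 1)) *
      cfValue d r k = (-1) ^ k by
    rw [hh]; simp
  rw [hv, ← hdet]
  field_simp
  linear_combination ((d k + r (k + 1)) * cfDen d (k + 1)) * h4 +
    (cfDen d (k + 1)) * (cfDen d k * ξ - cfNum a d k) * h3

/-- The contribution of the `k`-th convergent to the best constant. -/
theorem cfValue_eq (h : IsCF ξ a d r) (k : ℕ) :
    1 / |(cfDen d (k + 1) : ℝ) * (cfDen d (k + 1) * ξ - cfNum a d (k + 1))| = cfValue d r k := by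
  have h1 := h.diff_mul k
  have h2 : |(cfDen d (k + 1) : ℝ) * (cfDen d (k + 1) * ξ - cfNum a d (k + 1))| ≠ 0 := by
    intro h0; rw [h0] at h1; simp at h1
  rw [div_eq_iff h2]; linarith

/-- A fraction whose denominator lies between those of two consecutive convergents either is a
bad approximation or is no better than the first of them. -/
theorem value_le (h : IsCF ξ a d r) (k : ℕ) (p q : ℤ) (h1 : cfDen d (k + 1) ≤ q)
    (h2 : q < cfDen d (k + 2)) :
    1 / |(q : ℝ) * (q * ξ - p)| ≤ max 2 (cfValue d r k) := by
  set Q := cfDen d (k + 1) with hQ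
  set P := cfNum a d (k + 1) with hP
  set Q' := cfDen d (k + 2) with hQ'
  set P' := cfNum a d (k + 2) with hP'
  have hQpos : 0 < Q := h.den_pos k
  have hqpos : 0 < q := by linarith
  have hdet : Q' * P - Q * P' = (-1) ^ (k + 1) := cfDen_det a d (k + 1)
  set ε : ℤ := (-1) ^ (k + 1) with hε
  have hεε : ε * ε = 1 := by rw [hε, ← mul_pow]; simp
  -- Consecutive convergents form a unimodular matrix, so (p, q) is an integer combination of them
  -- with coefficients x, y.
  obtain ⟨x, hx⟩ : ∃ x, x = ε * (Q' * p - P' * q) := ⟨_, rfl⟩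
  obtain ⟨y, hy⟩ : ∃ y, y = ε * (P * q - Q * p) := ⟨_, rfl⟩
  have ep : p = x * P + y * P' := by
    rw [hx, hy]
    linear_combination (-p) * hεε - ε * p * hdet
  have eq : q = x * Q + y * Q' := by
    rw [hx, hy]
    linear_combination (-q) * hεε - ε * q * hdet
  have hstep : (Q' * ξ - P' : ℝ) = -r (k + 1) * (Q * ξ - P) := h.diff_step (k + 1)
  have hr0 := h.pos (k + 1)
  have hD := h.diff_ne_zero (k + 1)
  have hval := h.cfValue_eq k
  rw [← hQ, ← hP] at hval hD
  have hdiff : (q * ξ - p : ℝ) = (x - y * r (k + 1)) * (Q * ξ - P) := by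
    rw [eq, ep]; push_cast
    linear_combination (y : ℝ) * hstep
  have hx0 : x ≠ 0 := by
    rintro rfl
    have : 0 < y := by
      by_contra hy0
      have : y * Q' ≤ 0 := mul_nonpos_of_nonpos_of_nonneg (by linarith) (by linarith)
      linarith
    have : 1 * Q' ≤ y * Q' := mul_le_mul_of_nonneg_right this (by linarith)
    linarith
  have hQr : (0 : ℝ) < Q := by exact_mod_cast hQpos
  have hqr : (0 : ℝ) < q := by exact_mod_cast hqpos
  by_cases hy0 : y = 0
  · apply le_max_of_le_right
    rw [← hval]
    have hx1 : (1 : ℝ) ≤ |(x : ℝ)| := by exact_mod_cast Int.one_le_abs hx0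
    apply one_div_le_one_div_of_le (abs_pos.2 (mul_ne_zero hQr.ne' hD))
    rw [hdiff, hy0]
    rw [abs_mul, abs_mul, abs_mul, abs_of_pos hQr, abs_of_pos hqr]
    have : (Q : ℝ) ≤ q := by exact_mod_cast h1
    have hh : |(x : ℝ) - ((0 : ℤ) : ℝ) * r (k + 1)| = |(x : ℝ)| := by simp
    rw [hh]
    apply mul_le_mul this _ (abs_nonneg _) hqr.le
    exact le_mul_of_one_le_left (abs_nonneg _) hx1
  -- The bounds on q force x and y to have opposite signs, while the errors of the two convergents
  -- also alternate. Hence nothing cancels and |qξ - p| ≥ |Qξ - P|. Then 1 ≤ |Pq - Qp| ≤ 2q|qξ - p|.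
  · apply le_max_of_le_left
    have habs : (1 : ℝ) ≤ |(x : ℝ) - y * r (k + 1)| := by
      rcases lt_or_gt_of_ne hx0 with hx1 | hx1
      · have : 0 < y := by
          by_contra hyn
          have h3 : y * Q' ≤ 0 := mul_nonpos_of_nonpos_of_nonneg (by linarith) (by linarith)
          have h4 : x * Q ≤ 0 := mul_nonpos_of_nonpos_of_nonneg (by linarith) (by linarith)
          linarith
        have h5 : (x : ℝ) ≤ -1 := by exact_mod_cast (by omega : x ≤ -1)
        have h6 : (0 : ℝ) < y := by exact_mod_cast this
        have := mul_pos h6 hr0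
        rw [abs_of_neg (by linarith)]; linarith
      · have : y < 0 := by
          by_contra hyn
          have h3 : 1 * Q' ≤ y * Q' := mul_le_mul_of_nonneg_right (by omega) (by linarith)
          have h4 : 0 < x * Q := mul_pos hx1 hQpos
          linarith
        have h5 : (1 : ℝ) ≤ x := by exact_mod_cast hx1
        have h6 : (y : ℝ) < 0 := by exact_mod_cast this
        have := mul_neg_of_neg_of_pos h6 hr0
        rw [abs_of_pos (by linarith)]; linarith
    have hle : |(Q * ξ - P : ℝ)| ≤ |(q * ξ - p : ℝ)| := by
      rw [hdiff, abs_mul]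
      exact le_mul_of_one_le_left (abs_nonneg _) habs
    have hne : P * q - Q * p ≠ 0 := by
      intro h0; rw [h0] at hy; simp at hy; exact hy0 hy
    have h7 : (1 : ℝ) ≤ |(P * q - Q * p : ℝ)| := by exact_mod_cast Int.one_le_abs hne
    have h8 : (P * q - Q * p : ℝ) = Q * (q * ξ - p) - q * (Q * ξ - P) := by ring
    have h9 : |(Q : ℝ) * (q * ξ - p) - q * (Q * ξ - P)| ≤
        Q * |(q * ξ - p : ℝ)| + q * |(Q * ξ - P : ℝ)| := by
      refine (abs_sub _ _).trans ?_
      rw [abs_mul, abs_mul, abs_of_pos hQr, abs_of_pos hqr]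
    have h10 : (Q : ℝ) * |(q * ξ - p : ℝ)| ≤ q * |(q * ξ - p : ℝ)| :=
      mul_le_mul_of_nonneg_right (by exact_mod_cast h1) (abs_nonneg _)
    have h11 : (q : ℝ) * |(Q * ξ - P : ℝ)| ≤ q * |(q * ξ - p : ℝ)| :=
      mul_le_mul_of_nonneg_left hle hqr.le
    rw [h8] at h7
    rw [abs_mul, abs_of_pos hqr]
    rw [div_le_iff₀ (by linarith)]
    linarith

theorem exists_den_le_lt (h : IsCF ξ a d r) (K : ℕ) (q : ℤ) (hq : cfDen d (K + 1) ≤ q) :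
    ∃ k, K ≤ k ∧ cfDen d (k + 1) ≤ q ∧ q < cfDen d (k + 2) := by
  by_contra! hc
  have key : ∀ m, cfDen d (K + m + 1) ≤ q := by
    intro m
    induction m with
    | zero => exact hq
    | succ m ih => exact hc (K + m) (by omega) ih
  have h1 := key (q.toNat + 1)
  have h2 := h.den_ge (K + (q.toNat + 1))
  push_cast at h2
  have := Int.self_le_toNat q
  omega

theorem abs_diff_le_one (h : IsCF ξ a d r) (k : ℕ) :
    |(cfDen d k * ξ - cfNum a d k : ℝ)| ≤ 1 := by
  induction k with
  | zero => simp [cfDen, cfNum]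
  | succ k ih =>
    rw [h.diff_step, abs_mul, abs_neg, abs_of_pos (h.pos k)]
    exact mul_le_one₀ (h.lt_one k).le (abs_nonneg _) ih

/-- For ξ = 0 the numerators could stay bounded; for ξ ≠ 0 they grow like the denominators times
|ξ|. -/
theorem tendsto_convergents (h : IsCF ξ a d r) (hξ : ξ ≠ 0) :
    Tendsto (fun k => (cfNum a d (k + 1), (cfDen d (k + 1)).toNat)) atTop
      (cofinite ×ˢ (atTop : Filter ℕ)) := by
  have hden : ∀ k : ℕ, (k : ℝ) ≤ cfDen d (k + 1) := fun k => by exact_mod_cast h.den_ge k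
  refine Tendsto.prodMk ?_ ?_
  · rw [← Filter.cocompact_eq_cofinite, ← Metric.cobounded_eq_cocompact,
      ← tendsto_norm_atTop_iff_cobounded]
    have hlow : ∀ k : ℕ, (k : ℝ) * |ξ| + (-1) ≤ ‖cfNum a d (k + 1)‖ := by
      intro k
      rw [Int.norm_eq_abs]
      have h1 := h.abs_diff_le_one (k + 1)
      have h2 : |(cfDen d (k + 1) * ξ : ℝ)| ≤
        |(cfDen d (k + 1) * ξ - cfNum a d (k + 1) : ℝ)| + |(cfNum a d (k + 1) : ℝ)| := by
        have := abs_add_le (cfDen d (k + 1) * ξ - cfNum a d (k + 1) : ℝ) (cfNum a d (k + 1))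
        simpa using this
      rw [abs_mul, abs_of_pos (by exact_mod_cast h.den_pos k : (0 : ℝ) < cfDen d (k + 1))] at h2
      have := mul_le_mul_of_nonneg_right (hden k) (abs_nonneg ξ)
      linarith
    refine tendsto_atTop_mono hlow ?_
    exact tendsto_atTop_add_const_right _ _
      (tendsto_natCast_atTop_atTop.atTop_mul_const (abs_pos.2 hξ))
  · refine tendsto_atTop_mono (fun k => ?_) tendsto_id
    have := h.den_ge k
    simp only [id]; omega

theorem value_convergent (h : IsCF ξ a d r) (k : ℕ) :
    (1 / |(((cfDen d (k + 1)).toNat : ℕ) : ℝ) *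
      ((((cfDen d (k + 1)).toNat : ℕ) : ℝ) * ξ - (cfNum a d (k + 1) : ℝ))| : ℝ) =
      cfValue d r k := by
  have : (((cfDen d (k + 1)).toNat : ℕ) : ℝ) = cfDen d (k + 1) := by
    have := Int.toNat_of_nonneg (h.den_pos k).le
    exact_mod_cast this
  rw [this, h.cfValue_eq]

theorem eventually_of_bestConstant_lt (h : IsCF ξ a d r) (hξ : ξ ≠ 0) {B : EReal}
    (hB : bestConstant ξ < B) : ∀ᶠ k in atTop, (cfValue d r k : EReal) < B := by
  have h1 := Filter.eventually_lt_of_limsup_lt hB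
  have h2 := (h.tendsto_convergents hξ).eventually h1
  filter_upwards [h2] with k hk
  simpa only [h.value_convergent] using hk

/-- The assumption 2 ≤ B absorbs all fractions other than convergents and their multiples. -/
theorem bestConstant_le (h : IsCF ξ a d r) {B : ℝ} (hB : 2 ≤ B)
    (hv : ∀ᶠ k in atTop, cfValue d r k ≤ B) : bestConstant ξ ≤ B := by
  obtain ⟨K, hK⟩ := eventually_atTop.1 hv
  apply Filter.limsup_le_of_le
  · isBoundedDefault
  have : ∀ᶠ x : ℤ × ℕ in cofinite ×ˢ atTop, (cfDen d (K + 1)).toNat ≤ x.2 :=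
    tendsto_snd.eventually (eventually_ge_atTop _)
  filter_upwards [this] with x hx
  have hx' : cfDen d (K + 1) ≤ (x.2 : ℤ) := by omega
  obtain ⟨k, hk, h1, h2⟩ := h.exists_den_le_lt K x.2 hx'
  have h3 := h.value_le k x.1 x.2 h1 h2
  have h4 : max 2 (cfValue d r k) ≤ B := max_le hB (hK k hk)
  have h5 := h3.trans h4
  rw [Int.cast_natCast] at h5
  exact_mod_cast h5

theorem bestConstant_eq (h : IsCF ξ a d r) (hξ : ξ ≠ 0) {B : ℝ} (hB : 2 ≤ B)
    (hv : ∀ ε > 0, ∀ᶠ k in atTop, cfValue d r k ≤ B + ε)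
    (hf : ∀ ε > 0, ∃ᶠ k in atTop, B - ε ≤ cfValue d r k) : bestConstant ξ = B := by
  apply le_antisymm
  · apply EReal.le_of_forall_lt_iff_le.1
    intro z hz
    have hz' : B < z := by exact_mod_cast hz
    have := h.bestConstant_le (B := z) (by linarith) (by simpa using hv (z - B) (by linarith))
    exact this
  · by_contra! hc
    obtain ⟨z, hz1, hz2⟩ := EReal.lt_iff_exists_real_btwn.1 hc
    have hz' : z < B := by exact_mod_cast hz2
    have h1 := h.eventually_of_bestConstant_lt hξ hz1
    obtain ⟨k, hk1, hk2⟩ := ((hf (B - z) (by linarith)).and_eventually h1).exists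
    have : cfValue d r k < z := by exact_mod_cast hk2
    linarith

end IsCF

/-! ### Two-letter words with Markov's property. -/

/-- Whenever the letter of `w` changes between `i` and `i + 1`, the words read leftwards from `i - 1`
and rightwards from `i + 2` agree for `n < N` letters, and then carry the letters `w (i + 1)`
and `w i` respectively. -/
def MarkovWord (N : ℕ) (w : ℕ → Bool) (K : ℕ) : Prop :=
  ∀ i, K ≤ i → w i ≠ w (i + 1) → ∃ n < N, (∀ j < n, w (i - 1 - j) = w (i + 2 + j)) ∧
    w (i - 1 - n) = w (i + 1) ∧ w (i + 2 + n) = w i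

/-- Eventual periodicity of a sequence. -/
def EventuallyPeriodic {A : Type*} (w : ℕ → A) : Prop :=
  ∃ K p, 0 < p ∧ ∀ i, K ≤ i → w (i + p) = w i

theorem alternating_eq {f : ℕ → Bool} {m : ℕ} (h : ∀ j < m, f j ≠ f (j + 1)) :
    ∀ j ≤ m, f j = if Even j then f 0 else !f 0 := by
  intro j
  induction j with
  | zero => simp
  | succ j ih =>
    intro hj
    have h1 := ih (by omega)
    have h2 := h j (by omega)
    by_cases he : Even j
    · have : ¬ Even (j + 1) := by simpa [Nat.even_add_one] using he
      simp only [he, this, if_true, if_false] at h1 ⊢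
      rw [← h1]; exact (Bool.eq_not.2 h2.symm)
    · have : Even (j + 1) := by simpa [Nat.even_add_one] using he
      simp only [he, this, if_true, if_false] at h1 ⊢
      rw [h1] at h2
      cases h3 : f 0 <;> cases h4 : f (j + 1) <;> simp_all

namespace MarkovWord

variable {N K : ℕ} {w : ℕ → Bool}

/-- The forbidden factor is a(ab)^k b. Apply the condition at its last change ab: leftwards one
reads (ba)^(k-1) a, and the right side starts with b. The first difference must be b on the left
against a on the right, so either it occurs after (ba)^m with 1 ≤ m < k, or the right side begins
with (ba)^(k-1) a. Both cases produce the factor b(ba)^m a with smaller m, which is forbidden by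
induction with the letters exchanged. -/
theorem no_opposite_squares (h : MarkovWord N w K) (k : ℕ) : ∀ p, K ≤ p → 1 ≤ k →
    w p = w (p + 1) → (∀ j < 2 * k - 1, w (p + 1 + j) ≠ w (p + 1 + j + 1)) →
    w (p + 2 * k) = w (p + 2 * k + 1) → False := by
  induction k using Nat.strong_induction_on with
  | _ k ih =>
  intro p hp hk h0 halt h1
  have hlet := alternating_eq (f := fun j => w (p + 1 + j)) halt
  simp only [add_zero] at hlet
  have hb : w (p + 2 * k) = !w (p + 1) := by
    have := hlet (2 * k - 1) le_rfl
    have he : ¬ Even (2 * k - 1) := by rw [Nat.not_even_iff]; omega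
    rw [if_neg he] at this
    rw [← this]; congr 1; omega
  have ha : w (p + 2 * k - 1) = w (p + 1) := by
    have := hlet (2 * k - 2) (by omega)
    have he : Even (2 * k - 2) := by rw [Nat.even_iff]; omega
    rw [if_pos he] at this
    rw [← this]; congr 1; omega
  obtain ⟨n, hn, hag, hl, hr⟩ := h (p + 2 * k - 1) (by omega) (by
    rw [ha, show p + 2 * k - 1 + 1 = p + 2 * k by omega, hb]; simp)
  rw [show p + 2 * k - 1 + 1 = p + 2 * k by omega, hb] at hl
  rw [ha] at hr
  have hx0 : w (p + 2 * k + 1) = !w (p + 1) := by rw [← h1, hb]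
  -- letters to the left
  have hleft : ∀ j ≤ 2 * k - 3, 2 ≤ k →
      w (p + 2 * k - 1 - 1 - j) = if Even j then !w (p + 1) else w (p + 1) := by
    intro j hj hk2
    have := hlet (2 * k - 3 - j) (by omega)
    rw [show p + 2 * k - 1 - 1 - j = p + 1 + (2 * k - 3 - j) by omega, this]
    by_cases he : Even j
    · have : ¬ Even (2 * k - 3 - j) := by
        rw [Nat.even_iff] at he; rw [Nat.not_even_iff]; omega
      simp [he, this]
    · have : Even (2 * k - 3 - j) := by
        rw [Nat.not_even_iff] at he; rw [Nat.even_iff]; omega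
      simp [he, this]
  have hend : w (p + 2 * k - 1 - 1 - (2 * k - 2)) = w (p + 1) := by
    rw [← h0]; congr 1; omega
  have hn0 : n ≠ 0 := by
    rintro rfl
    rw [show p + 2 * k - 1 + 2 + 0 = p + 2 * k + 1 by omega, hx0] at hr
    simp at hr
  have hk2 : 2 ≤ k := by
    by_contra hk2
    obtain rfl : k = 1 := by omega
    have h2 := hag 0 (by omega)
    rw [show p + 2 * 1 - 1 + 2 + 0 = p + 2 * 1 + 1 by omega, hx0] at h2
    rw [show p + 2 * 1 - 1 - 1 - 0 = p by omega, h0] at h2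
    simp at h2
  have hnend : n ≠ 2 * k - 2 := by
    rintro rfl
    rw [hend] at hl; simp at hl
  -- a descent step with `x = (b a)^m a`
  have descend : ∀ m, 1 ≤ m → m < k → (∀ j < 2 * m, w (p + 2 * k + 1 + j) =
      if Even j then !w (p + 1) else w (p + 1)) → w (p + 2 * k + 1 + 2 * m) = w (p + 1) →
      False := by
    intro m hm1 hmk hx hxe
    refine ih m hmk (p + 2 * k) (by omega) hm1 h1 ?_ ?_
    · intro j hj
      rw [hx j (by omega), add_assoc (p + 2 * k + 1), hx (j + 1) (by omega)]
      by_cases he : Even j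
      · have : ¬ Even (j + 1) := by simpa [Nat.even_add_one] using he
        simp [he, this]
      · have : Even (j + 1) := by simpa [Nat.even_add_one] using he
        simp [he, this]
    · rw [show p + 2 * k + 2 * m + 1 = p + 2 * k + 1 + 2 * m by omega, hxe]
      have := hx (2 * m - 1) (by omega)
      rw [if_neg (by rw [Nat.not_even_iff]; omega)] at this
      rw [← this]; congr 1; omega
  rcases lt_or_ge n (2 * k - 2) with hlt | hge
  · have h2 := hleft n (by omega) hk2
    have he : Even n := by
      by_contra he
      rw [if_neg he, hl] at h2; simp at h2
    obtain ⟨m, hm⟩ := he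
    refine descend m (by omega) (by omega) ?_ ?_
    · intro j hj
      rw [show p + 2 * k + 1 + j = p + 2 * k - 1 + 2 + j by omega, ← hag j (by omega)]
      exact hleft j (by omega) hk2
    · rw [← hr]; congr 1; omega
  · refine descend (k - 1) (by omega) (by omega) ?_ ?_
    · intro j hj
      rw [show p + 2 * k + 1 + j = p + 2 * k - 1 + 2 + j by omega, ← hag j (by omega)]
      exact hleft j (by omega) hk2
    · rw [← hend, hag _ (by omega)]; congr 1; omega

/-- Between two successive squares the word alternates, so squares of different letters would form
the factor excluded by `no_opposite_squares`. The induction tracks the last square seen. -/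
theorem square_letter_eq (h : MarkovWord N w K) {p : ℕ} (hp : K ≤ p) (hsq : w p = w (p + 1)) :
    ∀ q, p ≤ q → w q = w (q + 1) → w q = w p := by
  have inv : ∀ q, p ≤ q → ∃ q', p ≤ q' ∧ q' ≤ q ∧ w q' = w (q' + 1) ∧ w q' = w p ∧
      ∀ j, q' < j → j ≤ q → w j ≠ w (j + 1) := by
    intro q hq
    induction q, hq using Nat.le_induction with
    | base => exact ⟨p, le_rfl, le_rfl, hsq, rfl, fun j h1 h2 => by omega⟩
    | succ q hq ih =>
      obtain ⟨q', h1, h2, h3, h4, h5⟩ := ih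
      by_cases hd : w (q + 1) = w (q + 1 + 1)
      · by_cases hl : w (q + 1) = w p
        · exact ⟨q + 1, by omega, le_rfl, hd, hl, fun j h1 h2 => by omega⟩
        · exfalso
          have halt : ∀ j < q - q', w (q' + 1 + j) ≠ w (q' + 1 + j + 1) :=
            fun j hj => h5 _ (by omega) (by omega)
          have h6 := alternating_eq (f := fun j => w (q' + 1 + j)) halt (q - q') le_rfl
          simp only [add_zero] at h6
          rw [show q' + 1 + (q - q') = q + 1 by omega] at h6
          have hodd : ¬ Even (q - q') := by
            intro he
            rw [if_pos he, ← h3, h4] at h6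
            exact hl h6
          rw [Nat.not_even_iff] at hodd
          refine h.no_opposite_squares ((q - q' + 1) / 2) q' (by omega) (by omega) h3 ?_ ?_
          · intro j hj; exact halt j (by omega)
          · rw [show q' + 2 * ((q - q' + 1) / 2) = q + 1 by omega]; exact hd
      · refine ⟨q', h1, by omega, h3, h4, fun j hj1 hj2 => ?_⟩
        rcases Nat.lt_or_ge q j with hj | hj
        · obtain rfl : j = q + 1 := by omega
          exact hd
        · exact h5 j hj1 hj
  intro q hq hd
  obtain ⟨q', h1, h2, h3, h4, h5⟩ := inv q hq
  rcases Nat.lt_or_ge q' q with hj | hj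
  · exact absurd hd (h5 q hj le_rfl)
  · obtain rfl : q' = q := by omega
    exact h4

theorem exists_square_letter (h : MarkovWord N w K) :
    ∃ a K', K ≤ K' ∧ ∀ i, K' ≤ i → w i = w (i + 1) → w i = a := by
  by_cases hd : ∃ p, K ≤ p ∧ w p = w (p + 1)
  · obtain ⟨p, hp, hsq⟩ := hd
    exact ⟨w p, p, hp, h.square_letter_eq hp hsq⟩
  · push Not at hd
    exact ⟨true, K, le_rfl, fun i hi h1 => absurd h1 (hd i hi)⟩

end MarkovWord

/-! ### Desubstitution into the blocks a and ab. -/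

/-- Starting positions of the blocks `a`, `a b` into which `w` decomposes after `s`. -/
def blockStart (w : ℕ → Bool) (a : Bool) (s : ℕ) : ℕ → ℕ
  | 0 => s
  | i + 1 => blockStart w a s i + (if w (blockStart w a s i + 1) = a then 1 else 2)

/-- The word of blocks: `a` for the block `a`, and the other letter `b` for the block `a b`. -/
def blockWord (w : ℕ → Bool) (a : Bool) (s : ℕ) (i : ℕ) : Bool := w (blockStart w a s i + 1)

section Desubstitution

variable {w : ℕ → Bool} {a : Bool} {s : ℕ}

theorem blockStart_succ (i : ℕ) : blockStart w a s (i + 1) =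
    blockStart w a s i + (if blockWord w a s i = a then 1 else 2) := rfl

theorem le_blockStart (i : ℕ) : s + i ≤ blockStart w a s i := by
  induction i with
  | zero => simp [blockStart]
  | succ i ih => rw [blockStart_succ]; split_ifs <;> omega

theorem apply_blockStart (hs : w s = a) (hsq : ∀ i, s ≤ i → w i = w (i + 1) → w i = a) (i : ℕ) :
    w (blockStart w a s i) = a := by
  induction i with
  | zero => exact hs
  | succ i ih =>
    rw [blockStart_succ]
    split_ifs with h1
    · exact h1
    · have h2 := hsq (blockStart w a s i + 1) (by linarith [le_blockStart (w := w) (a := a) (s := s) i])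
      by_contra h3
      apply h1
      apply h2
      change w (blockStart w a s i + 1) ≠ a at h1
      change w (blockStart w a s i + 1 + 1) ≠ a at h3
      rw [Bool.eq_not.2 h1, Bool.eq_not.2 h3]

theorem apply_blockStart_sub_one (hs : w s = a)
    (hsq : ∀ i, s ≤ i → w i = w (i + 1) → w i = a) (i : ℕ) :
    w (blockStart w a s (i + 1) - 1) = blockWord w a s i := by
  rw [blockStart_succ]
  split_ifs with h1
  · rw [Nat.add_sub_cancel, h1]; exact apply_blockStart hs hsq i
  · rfl

theorem exists_blockStart (k : ℕ) {I : ℕ} (hk : blockStart w a s I ≤ k) :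
    ∃ i, I ≤ i ∧ (k = blockStart w a s i ∨ k = blockStart w a s i + 1) := by
  induction k, hk using Nat.le_induction with
  | base => exact ⟨I, le_rfl, Or.inl rfl⟩
  | succ k hk ih =>
    obtain ⟨i, hi, h1 | h1⟩ := ih
    · exact ⟨i, hi, Or.inr (by omega)⟩
    · have h2 := blockStart_succ (w := w) (a := a) (s := s) i
      refine ⟨i + 1, by omega, ?_⟩
      split_ifs at h2 <;> omega

/-- A period of the block word advances the block starts by a fixed amount, which is a period of
`w`. -/
theorem EventuallyPeriodic.of_blockWord (hs : w s = a)
    (hsq : ∀ i, s ≤ i → w i = w (i + 1) → w i = a)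
    (h : EventuallyPeriodic (blockWord w a s)) : EventuallyPeriodic w := by
  obtain ⟨K, p, hp, hper⟩ := h
  have hmono : ∀ i m, blockStart w a s i + m ≤ blockStart w a s (i + m) := by
    intro i m
    induction m with
    | zero => simp
    | succ m ih => rw [← add_assoc i, blockStart_succ]; split_ifs <;> omega
  have hshift : ∀ i, K ≤ i → blockStart w a s (i + p) =
      blockStart w a s i + (blockStart w a s (K + p) - blockStart w a s K) := by
    intro i hi
    induction i, hi using Nat.le_induction with
    | base => have := hmono K p; omega
    | succ i hi ih =>
      rw [show i + 1 + p = i + p + 1 by omega, blockStart_succ, hper i hi, blockStart_succ, ih]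
      omega
  refine ⟨blockStart w a s K, blockStart w a s (K + p) - blockStart w a s K, ?_, ?_⟩
  · have := hmono K p; omega
  · intro k hk
    obtain ⟨i, hi, rfl | rfl⟩ := exists_blockStart k hk
    · rw [← hshift i hi, apply_blockStart hs hsq, apply_blockStart hs hsq]
    · rw [add_right_comm, ← hshift i hi]
      exact hper i hi

/-- Read leftwards from the start of block i and rightwards from the start of block i + 2, both
sides open with a common a. After it, both are read off from the blocks in the same way, since a·ba
= ab·a. Dropping this common letter is what lowers the bound by one. The threshold N + 2 keeps the
leftward indices from truncating at 0. -/
theorem MarkovWord.blockWord {N K : ℕ} (h : MarkovWord (N + 1) w K) (hK : K ≤ s) (hs : w s = a)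
    (hsq : ∀ i, s ≤ i → w i = w (i + 1) → w i = a) :
    MarkovWord N (blockWord w a s) (N + 2) := by
  intro i hi hne
  set S := blockStart w a s with hS
  set v := _root_.blockWord w a s with hv
  have hsucc : ∀ i, S (i + 1) = S i + (if v i = a then 1 else 2) := fun i => blockStart_succ i
  have hstart : ∀ i, w (S i) = a := apply_blockStart hs hsq
  have hnext : ∀ i, w (S i + 1) = v i := fun i => rfl
  have hprev : ∀ i, w (S (i + 1) - 1) = v i := apply_blockStart_sub_one hs hsq
  have hge : ∀ i, s + i ≤ S i := fun i => le_blockStart i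
  -- the change of letter in `w`
  obtain ⟨I, hI1, hI2, hwI, hwI1⟩ : ∃ I, I - 1 = S i ∧ I = S i + 1 ∧ w I = v i ∧ w (I + 1) = v (i + 1) ∧
      I + 2 = S (i + 2) := by
    have e1 := hsucc i
    have e2 : S (i + 2) = S (i + 1) + (if v (i + 1) = a then 1 else 2) := hsucc (i + 1)
    refine ⟨S i + 1, by omega, rfl, rfl, ?_, ?_⟩
    · by_cases ha : v i = a
      · rw [if_pos ha] at e1
        rw [← e1]; rfl
      · rw [if_neg ha] at e1
        rw [show S i + 1 + 1 = S (i + 1) by omega, hstart]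
        rw [Bool.eq_not.2 ha] at hne
        cases h1 : a <;> cases h2 : v (i + 1) <;> simp_all
    · by_cases ha : v i = a
      · have : v (i + 1) ≠ a := fun h => hne (ha.trans h.symm)
        rw [if_pos ha] at e1
        rw [if_neg this] at e2
        omega
      · have : v (i + 1) = a := by
          rw [Bool.eq_not.2 ha] at hne
          cases h1 : a <;> cases h2 : v (i + 1) <;> simp_all
        rw [if_neg ha] at e1
        rw [if_pos this] at e2
        omega
  obtain ⟨hwI1, hI3⟩ := hwI1
  obtain ⟨n, hn, hag, hl, hr⟩ := h I (by have := hge i; omega) (by rw [hwI, hwI1]; exact hne)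
  rw [hI1] at hl
  rw [hI1] at hag
  rw [hI3] at hr
  rw [hI3] at hag
  rw [hwI1] at hl
  rw [hwI] at hr
  have hdiff : w (S i - n) ≠ w (S (i + 2) + n) := by rw [hl, hr]; exact hne.symm
  -- Either the first differing block occurs among the first j, or j blocks agree on each side and
  -- occupy t letters, with j ≤ t < n. At j = N + 1 the latter contradicts n < N + 1.
  have key : ∀ j, j ≤ N + 1 → (∃ m < N, (∀ l < m, v (i - 1 - l) = v (i + 2 + l)) ∧
      v (i - 1 - m) = v (i + 1) ∧ v (i + 2 + m) = v i) ∨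
      ((∀ l < j, v (i - 1 - l) = v (i + 2 + l)) ∧ ∃ t, j ≤ t ∧ t < n ∧
        S (i + 2 + j) = S (i + 2) + t ∧ S i = S (i - j) + t) := by
    intro j
    induction j with
    | zero =>
      intro _
      right
      refine ⟨fun l hl => by omega, 0, le_rfl, ?_, by simp, by simp⟩
      rcases Nat.eq_zero_or_pos n with h0 | h0
      · subst h0
        exfalso; apply hdiff
        simp [hstart]
      · exact h0
    | succ j ih =>
      intro hj
      rcases ih (by omega) with h1 | ⟨h1, t, ht1, ht2, ht3, ht4⟩
      · exact Or.inl h1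
      have hxl : w (S i - (t + 1)) = v (i - 1 - j) := by
        have := hprev (i - 1 - j)
        rw [show i - 1 - j + 1 = i - j by omega] at this
        rw [← this]; congr 1; omega
      have hxr : w (S (i + 2) + (t + 1)) = v (i + 2 + j) := by
        rw [← hnext, ht3]; rfl
      by_cases heq : v (i - 1 - j) = v (i + 2 + j)
      · right
        have hn1 : t + 1 ≠ n := by
          rintro rfl
          apply hdiff; rw [hxl, hxr, heq]
        have e1 := hsucc (i + 2 + j)
        have e2 := hsucc (i - 1 - j)
        rw [show i - 1 - j + 1 = i - j by omega] at e2
        rw [heq] at e2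
        refine ⟨?_, t + (if v (i + 2 + j) = a then 1 else 2), ?_, ?_, ?_, ?_⟩
        · intro l hl
          rcases Nat.lt_or_ge l j with hlj | hlj
          · exact h1 l hlj
          · obtain rfl : l = j := by omega
            exact heq
        · split_ifs <;> omega
        · split_ifs with hva
          · omega
          · rw [if_neg hva] at e1 e2
            have : t + 2 ≠ n := by
              rintro rfl
              apply hdiff
              rw [show S (i + 2) + (t + 2) = S (i + 2 + j + 1) by omega,
                show S i - (t + 2) = S (i - 1 - j) by omega, hstart, hstart]
            omega
        · rw [show i + 2 + (j + 1) = i + 2 + j + 1 by omega, e1]; omega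
        · rw [show i - (j + 1) = i - 1 - j by omega]; omega
      · left
        have hn1 : t + 1 = n := by
          by_contra hn1
          have := hag (t + 1) (by omega)
          rw [hxl, hxr] at this
          exact heq this
        subst hn1
        refine ⟨j, by omega, h1, ?_, ?_⟩
        · rw [← hxl, hl]
        · rw [← hxr, hr]
  rcases key (N + 1) le_rfl with h1 | ⟨_, t, ht1, ht2, _⟩
  · exact h1
  · omega

end Desubstitution

/-- A word satisfying the Markov condition with a bound on the lengths is eventually periodic. -/
theorem MarkovWord.eventuallyPeriodic (N : ℕ) :
    ∀ (w : ℕ → Bool) (K : ℕ), MarkovWord N w K → EventuallyPeriodic w := by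
  induction N with
  | zero =>
    intro w K h
    refine ⟨K, 1, one_pos, fun i hi => ?_⟩
    by_contra hne
    obtain ⟨n, hn, _⟩ := h i hi (Ne.symm hne)
    omega
  | succ N ih =>
    intro w K h
    obtain ⟨a, K', hK, hsq⟩ := h.exists_square_letter
    obtain ⟨s, hs, hwa⟩ : ∃ s, K' ≤ s ∧ w s = a := by
      by_cases h0 : w K' = a
      · exact ⟨K', le_rfl, h0⟩
      · refine ⟨K' + 1, by omega, ?_⟩
        by_contra h1
        apply h0
        apply hsq K' le_rfl
        rw [Bool.eq_not.2 h0, Bool.eq_not.2 h1]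
    have hsq' : ∀ i, s ≤ i → w i = w (i + 1) → w i = a := fun i hi => hsq i (hs.trans hi)
    exact EventuallyPeriodic.of_blockWord hwa hsq'
      (ih _ _ (h.blockWord (hK.trans hs) hwa hsq'))

/-! ### From the order condition on digits to Markov's property. -/

/-- The order condition on a two-letter sequence `e`, in which no letter is isolated, forced by a
bound below `3` on the approximation constants. -/
structure BoundaryCondition (e : ℕ → Bool) (N K : ℕ) : Prop where
  no_isolated : ∀ i, K ≤ i → e i ≠ e (i + 1) → e (i + 1) = e (i + 2)
  boundary : ∀ i, K ≤ i → e (i - 1) = e i → e i ≠ e (i + 1) → e (i + 1) = e (i + 2) →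
    ∃ f < N, (∀ j < f, e (i - 2 - j) = e (i + 3 + j)) ∧
      (Even f → e (i - 2 - f) = e (i + 1) ∧ e (i + 3 + f) = e i) ∧
      (¬ Even f → e (i - 2 - f) = e i ∧ e (i + 3 + f) = e (i + 1))

namespace BoundaryCondition

variable {e : ℕ → Bool} {N K : ℕ}

/-- Apply the condition at the right end of an odd run of length 2m + 1. Leftwards, 2m - 1 letters
of the run remain, followed by the other letter. The parity rule excludes a first difference inside
the run at an even place, and one exactly at its end. Any other place copies an odd run of length f
or 2m - 1 to the right, and this shorter run is impossible by induction. -/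
theorem no_odd_run (h : BoundaryCondition e N K) (m : ℕ) : ∀ p, K ≤ p → e p ≠ e (p + 1) →
    (∀ j ≤ 2 * m, e (p + 1 + j) = e (p + 1)) → e (p + 1 + (2 * m + 1)) ≠ e (p + 1) → False := by
  induction m using Nat.strong_induction_on with
  | _ m ih =>
  intro p hp h0 hrun hend
  have hc : ∀ x : Bool, x ≠ e (p + 1) → x = !e (p + 1) := fun x hx => Bool.eq_not.2 hx
  rcases Nat.eq_zero_or_pos m with rfl | hm
  · exact hend (h.no_isolated p hp h0).symm
  have hi0 : e (p + 1 + 2 * m) = e (p + 1) := hrun _ le_rfl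
  have hi1 : e (p + 1 + 2 * m + 1) = !e (p + 1) := hc _ hend
  have hne : e (p + 1 + 2 * m) ≠ e (p + 1 + 2 * m + 1) := by rw [hi0, hi1]; simp
  have hi2 := h.no_isolated (p + 1 + 2 * m) (by omega) hne
  have him : e (p + 1 + 2 * m - 1) = e (p + 1 + 2 * m) := by
    rw [hi0, ← hrun (2 * m - 1) (by omega)]; congr 1; omega
  obtain ⟨f, hf, hag, hev, hod⟩ := h.boundary (p + 1 + 2 * m) (by omega) him hne hi2
  rw [hi0, hi1] at hev hod
  have hL : ∀ j ≤ 2 * m - 2, e (p + 1 + 2 * m - 2 - j) = e (p + 1) := by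
    intro j hj
    rw [← hrun (2 * m - 2 - j) (by omega)]; congr 1; omega
  have hLe : e (p + 1 + 2 * m - 2 - (2 * m - 1)) = !e (p + 1) := by
    rw [← hc _ h0]; congr 1; omega
  have descend : ∀ m' < m, (∀ j ≤ 2 * m', e (p + 1 + 2 * m + 3 + j) = e (p + 1)) →
      e (p + 1 + 2 * m + 3 + (2 * m' + 1)) = !e (p + 1) → False := by
    intro m' hm' h1 h2
    have h3 := h1 0 (by omega)
    rw [add_zero] at h3
    refine ih m' hm' (p + 1 + 2 * m + 2) (by omega) ?_ ?_ ?_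
    · rw [← hi2, hi1]
      change _ ≠ e (p + 1 + 2 * m + 3)
      rw [h3]; simp
    · intro j hj
      change e (p + 1 + 2 * m + 3 + j) = e (p + 1 + 2 * m + 3)
      rw [h1 j hj, h3]
    · change e (p + 1 + 2 * m + 3 + (2 * m' + 1)) ≠ e (p + 1 + 2 * m + 3)
      rw [h2, h3]; simp
  have hlong : 2 * m - 1 < f → False := by
    intro hlt
    refine descend (m - 1) (by omega) ?_ ?_
    · intro j hj
      rw [← hag j (by omega)]; exact hL j (by omega)
    · rw [← hag _ (by omega), ← hLe]; congr 2; omega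
  rcases lt_trichotomy f (2 * m - 1) with hlt | heq | hgt
  · have h1 := hL f (by omega)
    by_cases he : Even f
    · rw [(hev he).1] at h1; simp at h1
    · have ho := Nat.not_even_iff.1 he
      refine descend (f / 2) (by omega) ?_ ?_
      · intro j hj
        rw [← hag j (by omega)]; exact hL j (by omega)
      · rw [← (hod he).2]; congr 1; omega
  · have he : ¬ Even f := by rw [Nat.not_even_iff]; omega
    have := (hod he).1
    rw [heq, hLe] at this; simp at this
  · exact hlong hgt

theorem eventuallyPeriodic (h : BoundaryCondition e N K) : EventuallyPeriodic e := by
  by_cases hcst : ∀ p, K ≤ p → e p = e (p + 1)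
  · exact ⟨K, 1, one_pos, fun i hi => (hcst i hi).symm⟩
  push Not at hcst
  obtain ⟨p, hp, hne⟩ := hcst
  -- Here p + 1 + 2j starts the run containing the i-th pair of letters after the first change. Even
  -- run lengths keep all run starts aligned with the pairs.
  have pairs : ∀ i, ∃ j ≤ i, e (p + 2 * j) ≠ e (p + 1 + 2 * j) ∧
      ∀ l ≤ 2 * (i - j) + 1, e (p + 1 + 2 * j + l) = e (p + 1 + 2 * j) := by
    have fin : ∀ i j, j ≤ i → e (p + 2 * j) ≠ e (p + 1 + 2 * j) →
        (∀ l ≤ 2 * (i - j), e (p + 1 + 2 * j + l) = e (p + 1 + 2 * j)) →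
        ∀ l ≤ 2 * (i - j) + 1, e (p + 1 + 2 * j + l) = e (p + 1 + 2 * j) := by
      intro i j hj h1 h2 l hl
      rcases Nat.lt_or_ge l (2 * (i - j) + 1) with hl' | hl'
      · exact h2 l (by omega)
      · obtain rfl : l = 2 * (i - j) + 1 := by omega
        by_contra h3
        rw [show p + 1 + 2 * j = p + 2 * j + 1 by omega] at h1 h2 h3
        exact h.no_odd_run (i - j) (p + 2 * j) (by omega) h1 h2 h3
    intro i
    induction i with
    | zero =>
      refine ⟨0, le_rfl, hne, fin 0 0 le_rfl hne ?_⟩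
      intro l hl
      obtain rfl : l = 0 := by omega
      rfl
    | succ i ih =>
      obtain ⟨j, hj, h1, h2⟩ := ih
      by_cases h3 : e (p + 1 + 2 * j + (2 * (i - j) + 2)) = e (p + 1 + 2 * j)
      · refine ⟨j, by omega, h1, fin (i + 1) j (by omega) h1 ?_⟩
        intro l hl
        rcases Nat.lt_or_ge l (2 * (i - j) + 2) with hl' | hl'
        · exact h2 l (by omega)
        · obtain rfl : l = 2 * (i - j) + 2 := by omega
          exact h3
      · have h4 : e (p + 2 * (i + 1)) ≠ e (p + 1 + 2 * (i + 1)) := by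
          have := h2 (2 * (i - j) + 1) le_rfl
          rw [show p + 2 * (i + 1) = p + 1 + 2 * j + (2 * (i - j) + 1) by omega, this,
            show p + 1 + 2 * (i + 1) = p + 1 + 2 * j + (2 * (i - j) + 2) by omega]
          exact Ne.symm h3
        refine ⟨i + 1, le_rfl, h4, fin (i + 1) (i + 1) le_rfl h4 ?_⟩
        intro l hl
        obtain rfl : l = 0 := by omega
        rfl
  have pair : ∀ i, e (p + 1 + 2 * i + 1) = e (p + 1 + 2 * i) := by
    intro i
    obtain ⟨j, hj, _, h2⟩ := pairs i
    have h3 := h2 (2 * (i - j) + 1) le_rfl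
    have h4 := h2 (2 * (i - j)) (by omega)
    rw [show p + 1 + 2 * i + 1 = p + 1 + 2 * j + (2 * (i - j) + 1) by omega, h3, ← h4]
    congr 1; omega
  have hM : MarkovWord N (fun i => e (p + 1 + 2 * i)) (N + 2) := by
    intro i hi hch
    simp only at hch
    have e0 := pair i
    have e1 := pair (i + 1)
    obtain ⟨f, hf, hag, hev, hod⟩ := h.boundary (p + 1 + 2 * i + 1) (by omega) (by
      rw [Nat.add_sub_cancel]; exact e0.symm) (by
      rw [e0]; exact hch) e1.symm
    have hLp : ∀ n, n < i → e (p + 1 + 2 * i + 1 - 2 - 2 * n) = e (p + 1 + 2 * (i - 1 - n)) := by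
      intro n hn
      rw [← pair]; congr 1; omega
    have hLp' : ∀ n, n < i → e (p + 1 + 2 * i + 1 - 2 - (2 * n + 1)) =
        e (p + 1 + 2 * (i - 1 - n)) := by
      intro n hn
      congr 1; omega
    have hRp : ∀ n, e (p + 1 + 2 * i + 1 + 3 + 2 * n) = e (p + 1 + 2 * (i + 2 + n)) := by
      intro n; congr 1; omega
    have hRp' : ∀ n, e (p + 1 + 2 * i + 1 + 3 + (2 * n + 1)) = e (p + 1 + 2 * (i + 2 + n)) := by
      intro n; rw [← pair]; congr 1; omega
    -- An odd f would be the second place of a pair on both sides. The first places agree, so the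
    -- second ones cannot differ.
    have he : Even f := by
      by_contra hodd
      have ho := Nat.not_even_iff.1 hodd
      have h1 := hod hodd
      have h2 := hag (f - 1) (by omega)
      rw [show f = 2 * (f / 2) + 1 by omega, hLp' _ (by omega), hRp'] at h1
      rw [show f - 1 = 2 * (f / 2) by omega, hLp _ (by omega), hRp, h1.1, h1.2, e0] at h2
      exact hch h2
    obtain ⟨n, hn⟩ := he
    have h1 := hev ⟨n, hn⟩
    rw [show f = 2 * n by omega, hLp n (by omega), hRp n] at h1
    refine ⟨n, by omega, ?_, ?_, ?_⟩
    · intro j hj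
      have := hag (2 * j) (by omega)
      rw [hLp j (by omega), hRp j] at this
      exact this
    · exact h1.1
    · exact h1.2.trans e0
  obtain ⟨K', q, hq, hper⟩ := MarkovWord.eventuallyPeriodic N _ _ hM
  refine ⟨p + 1 + 2 * K', 2 * q, by omega, fun k hk => ?_⟩
  have h1 := hper ((k - (p + 1)) / 2) (by omega)
  simp only at h1
  rcases Nat.mod_two_eq_zero_or_one (k - (p + 1)) with h2 | h2
  · rw [show k = p + 1 + 2 * ((k - (p + 1)) / 2) by omega, ← h1]
    congr 1; omega
  · rw [show k = p + 1 + 2 * ((k - (p + 1)) / 2) + 1 by omega, pair, ← h1, ← pair]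
    congr 1; omega

end BoundaryCondition

/-! ### Expansions of irrationals; countability of periodic words. -/

theorem Irrational.exists_isCF {ξ : ℝ} (hξ : Irrational ξ) : ∃ a d r, IsCF ξ a d r := by
  have hfr : ∀ x : ℝ, Irrational x → Irrational (Int.fract x) := by
    intro x hx
    rw [← Int.self_sub_floor]
    exact hx.sub_intCast _
  let r : ℕ → ℝ := fun k => Nat.rec (Int.fract ξ) (fun _ x => Int.fract (1 / x)) k
  have hr : ∀ k, r (k + 1) = Int.fract (1 / r k) := fun k => rfl
  have hirr : ∀ k, Irrational (r k) := by
    intro k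
    induction k with
    | zero => exact hfr _ hξ
    | succ k ih => rw [hr, one_div]; exact hfr _ ih.inv
  have hnn : ∀ k, 0 ≤ r k := by
    intro k
    cases k with
    | zero => exact Int.fract_nonneg _
    | succ k => rw [hr]; exact Int.fract_nonneg _
  have hlt : ∀ k, r k < 1 := by
    intro k
    cases k with
    | zero => exact Int.fract_lt_one _
    | succ k => rw [hr]; exact Int.fract_lt_one _
  have hpos : ∀ k, 0 < r k := fun k => lt_of_le_of_ne (hnn k) (hirr k).ne_zero.symm
  refine ⟨⌊ξ⌋, fun k => ⌊1 / r k⌋₊, r, ⟨(Int.floor_add_fract ξ).symm, hpos, hlt, fun k => ?_⟩⟩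
  rw [hr, natCast_floor_eq_intCast_floor (by have := hpos k; positivity)]
  exact (Int.floor_add_fract _).symm

/-- Both numbers lie within 1/q of the same convergent p/q, with q unbounded. -/
theorem IsCF.eq_of_digits {ξ ξ' : ℝ} {a : ℤ} {d : ℕ → ℕ} {r r' : ℕ → ℝ} (h : IsCF ξ a d r)
    (h' : IsCF ξ' a d r') : ξ = ξ' := by
  by_contra hne
  have hpos : 0 < |ξ - ξ'| := abs_pos.2 (sub_ne_zero.2 hne)
  obtain ⟨k, hk⟩ := exists_nat_gt (2 / |ξ - ξ'|)
  rw [div_lt_iff₀ hpos] at hk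
  have h1 : (k : ℝ) ≤ cfDen d (k + 1) := by exact_mod_cast h.den_ge k
  have h0 : (0 : ℝ) < cfDen d (k + 1) := by exact_mod_cast h.den_pos k
  have h2 := h.abs_diff_le_one (k + 1)
  have h3 := h'.abs_diff_le_one (k + 1)
  have h4 : (cfDen d (k + 1) : ℝ) * |ξ - ξ'| ≤ 2 := by
    nth_rewrite 1 [← abs_of_pos h0]
    rw [← abs_mul]
    have : (cfDen d (k + 1) : ℝ) * (ξ - ξ') = (cfDen d (k + 1) * ξ - cfNum a d (k + 1)) -
      (cfDen d (k + 1) * ξ' - cfNum a d (k + 1)) := by ring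
    rw [this]
    refine (abs_sub _ _).trans ?_
    linarith
  have := mul_le_mul_of_nonneg_right h1 hpos.le
  linarith

/-- For a fixed preperiod K and period p, the first K + p letters determine the word. -/
theorem countable_eventuallyPeriodic (A : Type*) [Countable A] :
    {w : ℕ → A | EventuallyPeriodic w}.Countable := by
  have : {w : ℕ → A | EventuallyPeriodic w} ⊆
      ⋃ K : ℕ, ⋃ p : ℕ, {w : ℕ → A | 0 < p ∧ ∀ i, K ≤ i → w (i + p) = w i} := by
    rintro w ⟨K, p, hp⟩
    exact mem_iUnion.2 ⟨K, mem_iUnion.2 ⟨p, hp⟩⟩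
  refine Countable.mono this (countable_iUnion fun K => countable_iUnion fun p => ?_)
  refine MapsTo.countable_of_injOn (f := fun w (i : Fin (K + p)) => w i) (t := univ)
    (fun _ _ => mem_univ _) ?_ (to_countable _)
  rintro w ⟨hp, hw⟩ w' ⟨_, hw'⟩ heq
  funext i
  induction i using Nat.strong_induction_on with
  | _ i ih =>
  rcases Nat.lt_or_ge i (K + p) with hi | hi
  · exact congrFun heq ⟨i, hi⟩
  · have h1 := hw (i - p) (by omega)
    have h2 := hw' (i - p) (by omega)
    rw [show i - p + p = i by omega] at h1 h2
    rw [h1, h2]; exact ih _ (by omega)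

/-! ### Best constants below 3. -/

/-- Each common digit multiplies the difference by -u j * v j. The bound 3/4 is 1 / (1 + 1/3), valid
since expansions with digits 1 and 2 are at least 1/3. -/
theorem cf_tails_compare (u v a : ℕ → ℝ) (n : ℕ)
    (hu : ∀ j < n, u j * (a j + u (j + 1)) = 1 ∧ 0 < u j ∧ u j ≤ 3 / 4)
    (hv : ∀ j < n, v j * (a j + v (j + 1)) = 1 ∧ 0 < v j ∧ v j ≤ 3 / 4) :
    ∃ c, 0 < c ∧ c ≤ (9 / 16 : ℝ) ^ n ∧ u 0 - v 0 = (-1) ^ n * c * (u n - v n) := by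
  induction n with
  | zero => exact ⟨1, one_pos, by simp, by simp⟩
  | succ n ih =>
    obtain ⟨c, hc0, hc1, hc2⟩ := ih (fun j hj => hu j (by omega)) (fun j hj => hv j (by omega))
    obtain ⟨hu1, hu2, hu3⟩ := hu n (by omega)
    obtain ⟨hv1, hv2, hv3⟩ := hv n (by omega)
    refine ⟨c * (u n * v n), by positivity, ?_, ?_⟩
    · rw [pow_succ]
      refine mul_le_mul hc1 ?_ (by positivity) (by positivity)
      calc u n * v n ≤ (3 / 4) * (3 / 4) := mul_le_mul hu3 hv3 hv2.le (by norm_num)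
        _ = 9 / 16 := by norm_num
    · rw [hc2, pow_succ]
      have : u n - v n = -(u n * v n) * (u (n + 1) - v (n + 1)) := by
        linear_combination v n * hu1 - u n * hv1
      rw [this]; ring

namespace IsCF

variable {ξ : ℝ} {a : ℤ} {d : ℕ → ℕ} {r : ℕ → ℝ}

theorem tail_mul (h : IsCF ξ a d r) (k : ℕ) : r k * (d k + r (k + 1)) = 1 := by
  rw [← h.step]; field_simp [(h.pos k).ne']

theorem cfLeft_mul (h : IsCF ξ a d r) (k : ℕ) : cfLeft d (k + 1) * (d k + cfLeft d k) = 1 := by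
  have h1 : (1 : ℝ) ≤ d k := by exact_mod_cast h.one_le k
  have h2 := h.cfLeft_nonneg k
  simp only [cfLeft]
  field_simp

theorem cfLeft_succ_pos (h : IsCF ξ a d r) (k : ℕ) : 0 < cfLeft d (k + 1) := by
  have h1 : (1 : ℝ) ≤ d k := by exact_mod_cast h.one_le k
  have h2 := h.cfLeft_nonneg k
  simp only [cfLeft]
  positivity

theorem one_third_lt_tail (h : IsCF ξ a d r) {k : ℕ} (hd : d k ≤ 2) : 1 / 3 < r k := by
  have h1 := h.tail_mul k
  have h2 : (d k : ℝ) ≤ 2 := by exact_mod_cast hd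
  have h3 := h.lt_one (k + 1)
  have h4 := h.pos k
  nlinarith

theorem one_third_le_cfLeft (h : IsCF ξ a d r) {k : ℕ} (hd : d k ≤ 2) :
    1 / 3 ≤ cfLeft d (k + 1) := by
  have h1 := h.cfLeft_mul k
  have h2 : (d k : ℝ) ≤ 2 := by exact_mod_cast hd
  have h3 := h.cfLeft_le_one k
  have h4 := h.cfLeft_succ_pos k
  nlinarith

/-- The value at a boundary `2 2 | 1 1`. -/
theorem value_boundary_left (h : IsCF ξ a d r) {i : ℕ} (h0 : d i = 2) (h1 : d (i + 1) = 2)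
    (h2 : d (i + 2) = 1) (h3 : d (i + 3) = 1) :
    cfValue d r (i + 1) = 3 + 1 / (2 + cfLeft d i) - 1 / (2 + r (i + 4)) := by
  have e1 := h.tail_mul (i + 2)
  have e2 := h.tail_mul (i + 3)
  have p4 := h.pos (i + 4)
  rw [h2] at e1; rw [h3] at e2; push_cast at e1 e2
  have l0 := h.cfLeft_nonneg i
  have q3 : r (i + 3) = 1 / (1 + r (i + 4)) := eq_one_div_of_mul_eq_one_left e2
  have q2 : r (i + 2) = 1 / (1 + r (i + 3)) := eq_one_div_of_mul_eq_one_left e1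
  simp only [cfValue, cfLeft, h0, h1]
  rw [show i + 1 + 1 = i + 2 by omega, q2, q3]
  push_cast
  field_simp
  ring

/-- The value at a boundary `1 1 | 2 2`. -/
theorem value_boundary_right (h : IsCF ξ a d r) {i : ℕ} (h0 : d i = 1) (h1 : d (i + 1) = 1)
    (h2 : d (i + 2) = 2) (h3 : d (i + 3) = 2) :
    cfValue d r (i + 2) = 3 + 1 / (2 + r (i + 4)) - 1 / (2 + cfLeft d i) := by
  have e2 := h.tail_mul (i + 3)
  have p4 := h.pos (i + 4)
  rw [h3] at e2; push_cast at e2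
  have l0 := h.cfLeft_nonneg i
  have q3 : r (i + 3) = 1 / (2 + r (i + 4)) := eq_one_div_of_mul_eq_one_left e2
  simp only [cfValue, cfLeft, h0, h1, h2]
  rw [show i + 2 + 1 = i + 3 by omega, q3]
  push_cast
  field_simp
  ring

theorem digit_of_value_lt (h : IsCF ξ a d r) {k : ℕ} (hk : cfValue d r k < 3) :
    d k = 1 ∨ d k = 2 := by
  have h1 := h.one_le k
  have h2 := h.pos (k + 1)
  have h3 := h.cfLeft_nonneg k
  rw [cfValue] at hk
  have : (d k : ℝ) < 3 := by linarith
  have : d k < 3 := by exact_mod_cast this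
  omega

/-- Around 2 1 2 the value at the first 2 exceeds 2 + 2/3 + 1/3, and around 1 2 1 the value at the 2
exceeds 2 + 1/2 + 1/2. -/
theorem no_isolated_digit (h : IsCF ξ a d r) {K : ℕ} (hK : ∀ k, K ≤ k → cfValue d r k < 3)
    {i : ℕ} (hi : K < i) (hne : d i ≠ d (i + 1)) : d (i + 1) = d (i + 2) := by
  by_contra hne'
  have d0 := h.digit_of_value_lt (hK i (by omega))
  have d1 := h.digit_of_value_lt (hK (i + 1) (by omega))
  have d2 := h.digit_of_value_lt (hK (i + 2) (by omega))
  rcases d1 with d1 | d1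
  · have d0 : d i = 2 := by omega
    have d2 : d (i + 2) = 2 := by omega
    obtain ⟨j, rfl⟩ : ∃ j, i = j + 1 := ⟨i - 1, by omega⟩
    have dm := h.digit_of_value_lt (hK j (by omega))
    have l1 := h.one_third_le_cfLeft (k := j) (by omega)
    have e1 := h.tail_mul (j + 2)
    have e2 := h.tail_mul (j + 3)
    have p3 := h.pos (j + 3)
    have p4 := h.pos (j + 4)
    have p2 := h.pos (j + 2)
    rw [show j + 1 + 1 = j + 2 by omega] at d1
    rw [show j + 1 + 2 = j + 3 by omega] at d2
    rw [d1] at e1; rw [d2] at e2; push_cast at e1 e2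
    have b3 : r (j + 3) < 1 / 2 := by nlinarith
    have b2 : 2 / 3 < r (j + 2) := by nlinarith
    have hv := hK (j + 1) (by omega)
    rw [cfValue, d0, show j + 1 + 1 = j + 2 by omega] at hv
    push_cast at hv
    linarith
  · have d0 : d i = 1 := by omega
    have d2 : d (i + 2) = 1 := by omega
    have e1 := h.tail_mul (i + 2)
    have p3 := h.lt_one (i + 3)
    have p2 := h.pos (i + 2)
    rw [d2] at e1; push_cast at e1
    have b2 : 1 / 2 < r (i + 2) := by nlinarith
    have e2 := h.cfLeft_mul i
    have l1 := h.cfLeft_le_one i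
    have l2 := h.cfLeft_succ_pos i
    rw [d0] at e2; push_cast at e2
    have b1 : 1 / 2 ≤ cfLeft d (i + 1) := by nlinarith
    have hv := hK (i + 1) (by omega)
    rw [cfValue, d1, show i + 1 + 1 = i + 2 by omega] at hv
    push_cast at hv
    linarith

/-- The first difference between the digits to the left and to the right of a boundary is governed
by the comparison of the two continued fractions. -/
theorem exists_first_difference (h : IsCF ξ a d r) {K N : ℕ} {η : ℝ}
    (hη : (9 / 16 : ℝ) ^ N < η)
    (hK : ∀ k, K ≤ k → d k = 1 ∨ d k = 2) {i : ℕ} (hi : K + N + 2 ≤ i)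
    (hc : η ≤ |cfLeft d i - r (i + 4)|) :
    ∃ f < N, (∀ j < f, d (i - 1 - j) = d (i + 4 + j)) ∧ d (i - 1 - f) ≠ d (i + 4 + f) ∧
      ((0 < cfLeft d i - r (i + 4)) ↔ (Even f ↔ d (i - 1 - f) = 1)) := by
  have hL : ∀ j ≤ N, cfLeft d (i - j) * (d (i - 1 - j) + cfLeft d (i - (j + 1))) = 1 ∧
      0 < cfLeft d (i - j) ∧ cfLeft d (i - j) ≤ 3 / 4 := by
    intro j hj
    obtain ⟨m, hm⟩ : ∃ m, i - j = m + 2 := ⟨i - j - 2, by omega⟩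
    rw [hm, show i - 1 - j = m + 1 by omega, show i - (j + 1) = m + 1 by omega]
    refine ⟨h.cfLeft_mul (m + 1), h.cfLeft_succ_pos _, ?_⟩
    have h1 := h.cfLeft_mul (m + 1)
    have h2 := h.cfLeft_succ_pos (m + 1)
    have h3 := h.one_third_le_cfLeft (k := m) (by have := hK m (by omega); omega)
    have h4 : (1 : ℝ) ≤ d (m + 1) := by exact_mod_cast h.one_le _
    nlinarith
  have hR : ∀ j, r (i + 4 + j) * (d (i + 4 + j) + r (i + 4 + (j + 1))) = 1 ∧
      0 < r (i + 4 + j) ∧ r (i + 4 + j) ≤ 3 / 4 := by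
    intro j
    refine ⟨h.tail_mul _, h.pos _, ?_⟩
    have h1 := h.tail_mul (i + 4 + j)
    have h2 := h.pos (i + 4 + j)
    have h3 := h.one_third_lt_tail (k := i + 4 + j + 1)
      (by have := hK (i + 4 + j + 1) (by omega); omega)
    have h4 : (1 : ℝ) ≤ d (i + 4 + j) := by exact_mod_cast h.one_le _
    nlinarith
  -- Agreement on N digits would bring the two expansions within (9/16)^N < η of each other.
  have hex : ∃ f, f < N ∧ d (i - 1 - f) ≠ d (i + 4 + f) := by
    by_contra! hall
    obtain ⟨c, hc0, hc1, hc2⟩ := cf_tails_compare (fun j => cfLeft d (i - j))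
      (fun j => r (i + 4 + j)) (fun j => d (i - 1 - j)) N
      (fun j hj => hL j hj.le) (fun j hj => by rw [hall j hj]; exact hR j)
    simp only [Nat.sub_zero, add_zero] at hc2
    rw [hc2, abs_mul, abs_mul, abs_pow, abs_neg, abs_one, one_pow, one_mul, abs_of_pos hc0] at hc
    have h1 := hL N le_rfl
    have h2 := hR N
    have h3 : |cfLeft d (i - N) - r (i + 4 + N)| ≤ 1 := by
      rw [abs_le]; constructor <;> linarith [h1.2.1, h1.2.2, h2.2.1, h2.2.2]
    have : c * |cfLeft d (i - N) - r (i + 4 + N)| ≤ c := mul_le_of_le_one_right hc0.le h3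
    linarith
  classical
  obtain ⟨hfN, hfd⟩ := Nat.find_spec hex
  set f := Nat.find hex with hf
  have hag : ∀ j < f, d (i - 1 - j) = d (i + 4 + j) := by
    intro j hj
    have := Nat.find_min hex hj
    push Not at this
    exact this (by omega)
  refine ⟨f, hfN, hag, hfd, ?_⟩
  obtain ⟨c, hc0, hc1, hc2⟩ := cf_tails_compare (fun j => cfLeft d (i - j))
      (fun j => r (i + 4 + j)) (fun j => d (i - 1 - j)) f
      (fun j hj => hL j (by omega)) (fun j hj => by rw [hag j hj]; exact hR j)
  simp only [Nat.sub_zero, add_zero] at hc2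
  have h1 := hL f hfN.le
  have h2 := hR f
  have h3 := h.lt_one (i + 4 + (f + 1))
  have h3' := h.pos (i + 4 + (f + 1))
  have h4 := h.cfLeft_le_one (i - (f + 1))
  have h4' := h.cfLeft_nonneg (i - (f + 1))
  -- A leading digit 1 gives an expansion of at least 1/2 and a digit 2 one of at most 1/2; the sign
  -- (-1)^f transfers this comparison to the boundary.
  rcases hK (i - 1 - f) (by omega) with h5 | h5
  · have h6 : d (i + 4 + f) = 2 := by
      have := hK (i + 4 + f) (by omega); omega
    rw [h5] at h1; rw [h6] at h2; push_cast at h1 h2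
    have b1 : 1 / 2 ≤ cfLeft d (i - f) := by nlinarith [h1.1, h1.2.1]
    have b2 : r (i + 4 + f) < 1 / 2 := by nlinarith [h2.1, h2.2.1]
    have hpos : 0 < c * (cfLeft d (i - f) - r (i + 4 + f)) := mul_pos hc0 (by linarith)
    rw [hc2, mul_assoc]
    by_cases he : Even f
    · rw [he.neg_one_pow]; simp [he, h5, hpos]
    · rw [(Nat.not_even_iff_odd.1 he).neg_one_pow]; simp [he, h5]; linarith
  · have h6 : d (i + 4 + f) = 1 := by
      have := hK (i + 4 + f) (by omega); omega
    rw [h5] at h1; rw [h6] at h2; push_cast at h1 h2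
    have b1 : cfLeft d (i - f) ≤ 1 / 2 := by nlinarith [h1.1, h1.2.1]
    have b2 : 1 / 2 < r (i + 4 + f) := by nlinarith [h2.1, h2.2.1]
    have hpos : c * (cfLeft d (i - f) - r (i + 4 + f)) < 0 := mul_neg_of_pos_of_neg hc0 (by linarith)
    rw [hc2, mul_assoc]
    by_cases he : Even f
    · rw [he.neg_one_pow]; simp [he, h5]; linarith
    · rw [(Nat.not_even_iff_odd.1 he).neg_one_pow]; simp [he, h5]; linarith

theorem boundaryCondition (h : IsCF ξ a d r) {B : ℝ} (hB : B < 3) {K : ℕ}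
    (hK : ∀ k, K ≤ k → cfValue d r k < B) :
    ∃ N K', BoundaryCondition (fun k => decide (d k = 2)) N K' := by
  obtain ⟨N, hN⟩ := exists_pow_lt_of_lt_one (sub_pos.2 hB) (by norm_num : (9 / 16 : ℝ) < 1)
  have hK3 : ∀ k, K ≤ k → cfValue d r k < 3 := fun k hk => (hK k hk).trans hB
  have hdig : ∀ k, K ≤ k → d k = 1 ∨ d k = 2 := fun k hk => h.digit_of_value_lt (hK3 k hk)
  have hdec : ∀ k l, K ≤ k → K ≤ l → (decide (d k = 2) = decide (d l = 2) ↔ d k = d l) := by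
    intro k l hk hl
    have := hdig k hk
    have := hdig l hl
    rw [decide_eq_decide]; omega
  -- A boundary value below B keeps the two expansions at least 3 - B apart; N was chosen with
  -- (9/16)^N < 3 - B.
  have hsep : ∀ x y : ℝ, 0 ≤ x → 0 ≤ y → 3 + 1 / (2 + y) - 1 / (2 + x) < B → 3 - B ≤ y - x := by
    intro x y hx hy hlt
    have e1 : 1 / (2 + x) - 1 / (2 + y) = (y - x) / ((2 + x) * (2 + y)) := by
      field_simp; ring
    have e2 : 3 - B < (y - x) / ((2 + x) * (2 + y)) := by rw [← e1]; linarith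
    rw [lt_div_iff₀ (by positivity)] at e2
    have : 1 ≤ (2 + x) * (2 + y) := by nlinarith
    nlinarith
  refine ⟨N, K + N + 4, ⟨?_, ?_⟩⟩
  · intro i hi hne
    simp only [ne_eq] at hne ⊢
    rw [hdec _ _ (by omega) (by omega)] at hne
    rw [hdec _ _ (by omega) (by omega)]
    exact h.no_isolated_digit hK3 (by omega) hne
  · intro i hi h1 h2 h3
    simp only [ne_eq] at h1 h2 h3 ⊢
    rw [hdec _ _ (by omega) (by omega)] at h1 h2 h3
    obtain ⟨m, rfl⟩ : ∃ m, i = m + 1 := ⟨i - 1, by omega⟩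
    rw [Nat.add_sub_cancel] at h1
    change ¬ d (m + 1) = d (m + 2) at h2
    change d (m + 2) = d (m + 3) at h3
    have ln := h.cfLeft_nonneg m
    have rp := (h.pos (m + 4)).le
    have d0 := hdig m (by omega)
    have d2 := hdig (m + 2) (by omega)
    have hside : (d m = 2 → 3 - B ≤ cfLeft d m - r (m + 4)) ∧
        (d m = 1 → 3 - B ≤ r (m + 4) - cfLeft d m) := by
      constructor
      · intro hd
        refine hsep _ _ rp ln ?_
        rw [← h.value_boundary_left hd (by omega) (by omega) (by omega)]
        exact hK _ (by omega)
      · intro hd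
        refine hsep _ _ ln rp ?_
        rw [← h.value_boundary_right hd (by omega) (by omega) (by omega)]
        exact hK _ (by omega)
    obtain ⟨f, hf, hag, hfd, hiff⟩ := h.exists_first_difference hN hdig (i := m) (by omega) (by
      rcases d0 with d0 | d0
      · rw [abs_sub_comm]; exact (hside.2 d0).trans (le_abs_self _)
      · exact (hside.1 d0).trans (le_abs_self _))
    have hsgn : (0 < cfLeft d m - r (m + 4)) ↔ d m = 2 := by
      constructor
      · intro hpos
        rcases d0 with d0 | d0
        · have := hside.2 d0; linarith
        · exact d0
      · intro hd; have := hside.1 hd; linarith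
    rw [hsgn] at hiff
    have dl := hdig (m - 1 - f) (by omega)
    have dr := hdig (m + 4 + f) (by omega)
    refine ⟨f, hf, ?_, ?_, ?_⟩
    · intro j hj
      rw [hdec _ _ (by omega) (by omega)]
      rw [show m + 1 - 2 - j = m - 1 - j by omega, show m + 1 + 3 + j = m + 4 + j by omega]
      exact hag j hj
    · intro he
      rw [hdec _ _ (by omega) (by omega), hdec _ _ (by omega) (by omega)]
      rw [show m + 1 - 2 - f = m - 1 - f by omega, show m + 1 + 3 + f = m + 4 + f by omega]
      simp only [he, true_iff] at hiff
      rw [show m + 1 + 1 = m + 2 by omega] at *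
      omega
    · intro he
      rw [hdec _ _ (by omega) (by omega), hdec _ _ (by omega) (by omega)]
      rw [show m + 1 - 2 - f = m - 1 - f by omega, show m + 1 + 3 + f = m + 4 + f by omega]
      simp only [he, false_iff] at hiff
      rw [show m + 1 + 1 = m + 2 by omega] at *
      omega

theorem eventuallyPeriodic (h : IsCF ξ a d r) (hξ : ξ ≠ 0) (hlt : bestConstant ξ < 3) :
    EventuallyPeriodic d := by
  obtain ⟨B, hB1, hB2⟩ := EReal.lt_iff_exists_real_btwn.1 hlt
  have hB : B < 3 := EReal.coe_lt_coe_iff.1 hB2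
  obtain ⟨K, hK⟩ := eventually_atTop.1 (h.eventually_of_bestConstant_lt hξ hB1)
  have hK' : ∀ k, K ≤ k → cfValue d r k < B := fun k hk => by exact_mod_cast hK k hk
  obtain ⟨N, K', hbc⟩ := h.boundaryCondition hB hK'
  obtain ⟨M, p, hp, hper⟩ := hbc.eventuallyPeriodic
  refine ⟨max M K, p, hp, fun i hi => ?_⟩
  have h1 := hper i (le_of_max_le_left hi)
  have h2 := h.digit_of_value_lt ((hK' i (le_of_max_le_right hi)).trans hB)
  have h3 := h.digit_of_value_lt ((hK' (i + p) (by have := le_of_max_le_right hi; omega)).trans hB)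
  rw [decide_eq_decide] at h1
  omega

end IsCF

/-- The part of the Lagrange spectrum below `3` is countable. -/
theorem countable_lagrangeSpectrum_inter_Iio_three : (lagrangeSpectrum ∩ Iio 3).Countable := by
  -- The integer part and the digits determine ξ, and only countably many digit sequences are
  -- eventually periodic.
  have hc : {ξ : ℝ | ∃ a d r, IsCF ξ a d r ∧ EventuallyPeriodic d}.Countable := by
    choose! a d r hcf using fun (ξ : ℝ)
      (hξ : ∃ a d r, IsCF ξ a d r ∧ EventuallyPeriodic d) => hξ
    refine MapsTo.countable_of_injOn (f := fun ξ => (a ξ, d ξ))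
      (t := univ ×ˢ {w : ℕ → ℕ | EventuallyPeriodic w}) ?_ ?_
      (countable_univ.prod (countable_eventuallyPeriodic ℕ))
    · intro ξ hξ
      exact ⟨mem_univ _, (hcf ξ hξ).2⟩
    · intro ξ hξ ξ' hξ' heq
      simp only [Prod.mk.injEq] at heq
      have h1 := (hcf ξ hξ).1
      have h2 := (hcf ξ' hξ').1
      rw [← heq.1, ← heq.2] at h2
      exact h1.eq_of_digits h2
  refine (hc.image fun ξ => (bestConstant ξ).toReal).mono ?_
  rintro x ⟨⟨ξ, hξ, hx⟩, hlt⟩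
  obtain ⟨a, d, r, hcf⟩ := hξ.exists_isCF
  refine ⟨ξ, ⟨a, d, r, hcf, hcf.eventuallyPeriodic hξ.ne_zero ?_⟩, ?_⟩
  · rw [hx]; exact EReal.coe_lt_coe_iff.2 hlt
  · simp [hx]

theorem lagrangeDim_three : lagrangeDim 3 = 0 := by
  simp [lagrangeDim, countable_lagrangeSpectrum_inter_Iio_three.dimH_zero]

/-! ### Realising prescribed digits. -/

/-- A backward orbit of a sequence of uniform contractions of an interval. -/
theorem exists_backward_orbit (f : ℕ → ℝ → ℝ) {α β c : ℝ} (hαβ : α ≤ β) (hc0 : 0 ≤ c) (hc1 : c < 1)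
    (hmaps : ∀ k, ∀ x ∈ Icc α β, f k x ∈ Icc α β)
    (hlip : ∀ k, ∀ x ∈ Icc α β, ∀ y ∈ Icc α β, |f k x - f k y| ≤ c * |x - y|) :
    ∃ r : ℕ → ℝ, ∀ k, r k ∈ Icc α β ∧ r k = f k (r (k + 1)) := by
  -- F m k is f k ∘ ⋯ ∘ f (k + m - 1) applied to α, a Cauchy sequence in m by contraction.
  let F : ℕ → ℕ → ℝ := fun m => Nat.rec (fun _ => α) (fun _ g k => f k (g (k + 1))) m
  have hF : ∀ m k, F (m + 1) k = f k (F m (k + 1)) := fun _ _ => rfl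
  have hmem : ∀ m k, F m k ∈ Icc α β := by
    intro m
    induction m with
    | zero => exact fun k => ⟨le_rfl, hαβ⟩
    | succ m ih => exact fun k => hmaps k _ (ih (k + 1))
  have hdist : ∀ m k, |F m k - F (m + 1) k| ≤ (β - α) * c ^ m := by
    intro m
    induction m with
    | zero =>
      intro k
      have h1 := hmem 0 k
      have h2 := hmem (0 + 1) k
      rw [pow_zero, mul_one, abs_le]
      constructor <;> linarith [h1.1, h1.2, h2.1, h2.2]
    | succ m ih =>
      intro k
      rw [hF, hF (m + 1)]
      refine (hlip k _ (hmem m _) _ (hmem (m + 1) _)).trans ?_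
      have := mul_le_mul_of_nonneg_left (ih (k + 1)) hc0
      rw [pow_succ]; linarith
  have hlim : ∀ k, ∃ x, Tendsto (fun m => F m k) atTop (nhds x) := fun k =>
    cauchySeq_tendsto_of_complete
      (cauchySeq_of_le_geometric c (β - α) hc1 fun m => by rw [Real.dist_eq]; exact hdist m k)
  choose r hr using hlim
  have hrmem : ∀ k, r k ∈ Icc α β := fun k =>
    isClosed_Icc.mem_of_tendsto (hr k) (Eventually.of_forall fun m => hmem m k)
  refine ⟨r, fun k => ⟨hrmem k, ?_⟩⟩
  have h1 : Tendsto (fun m => F (m + 1) k) atTop (nhds (r k)) := (tendsto_add_atTop_iff_nat 1).2 (hr k)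
  have h2 : Tendsto (fun m => F (m + 1) k) atTop (nhds (f k (r (k + 1)))) := by
    rw [tendsto_iff_dist_tendsto_zero]
    have h3 := (tendsto_iff_dist_tendsto_zero.1 (hr (k + 1))).const_mul c
    rw [mul_zero] at h3
    refine squeeze_zero (fun _ => dist_nonneg) (fun m => ?_) h3
    rw [hF, Real.dist_eq, Real.dist_eq]
    exact hlip k _ (hmem m _) _ (hrmem _)
  exact tendsto_nhds_unique h1 h2

theorem exists_isCF_of_digits (d : ℕ → ℕ) (hd : ∀ k, d k = 1 ∨ d k = 2) :
    ∃ r : ℕ → ℝ, IsCF (r 0) 0 d r := by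
  have hd1 : ∀ k, (1 : ℝ) ≤ d k := fun k => by rcases hd k with h | h <;> rw [h] <;> norm_num
  have hd2 : ∀ k, (d k : ℝ) ≤ 2 := fun k => by rcases hd k with h | h <;> rw [h] <;> norm_num
  -- The maps x ↦ 1 / (d + x) preserve [1/3, 1]. Denominators there are at least 4/3, whence the
  -- constant 9/16.
  obtain ⟨r, hr⟩ := exists_backward_orbit (fun k x => 1 / (d k + x)) (α := 1 / 3) (β := 1)
    (c := 9 / 16) (by norm_num) (by norm_num) (by norm_num)
    (fun k x hx => by
      have h1 := hd1 k
      have h2 := hd2 k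
      have := hx.1
      have := hx.2
      have h0 : (0 : ℝ) < d k + x := by linarith
      constructor
      · rw [le_div_iff₀ h0]; linarith
      · rw [div_le_iff₀ h0]; linarith)
    (fun k x hx y hy => by
      have h1 := hd1 k
      have := hx.1
      have := hy.1
      have h0 : (4 / 3 : ℝ) ≤ d k + x := by linarith
      have h0' : (4 / 3 : ℝ) ≤ d k + y := by linarith
      have e : 1 / (d k + x) - 1 / (d k + y) = (y - x) / ((d k + x) * (d k + y)) := by
        have : (d k + x) ≠ 0 := by linarith
        have : (d k + y) ≠ 0 := by linarith
        field_simp; ring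
      rw [e, abs_div, abs_sub_comm, abs_of_pos (a := (d k + x) * (d k + y)) (by nlinarith),
        div_le_iff₀ (by nlinarith)]
      have h3 : (16 / 9 : ℝ) ≤ (d k + x) * (d k + y) := by nlinarith
      nlinarith [abs_nonneg (x - y)])
  refine ⟨r, ⟨by simp, fun k => ?_, fun k => ?_, fun k => ?_⟩⟩
  · linarith [(hr k).1.1]
  · rw [(hr k).2]
    have := (hr (k + 1)).1.1
    have := hd1 k
    rw [div_lt_one (by linarith)]; linarith
  · have := (hr k).2
    rw [this]; simp

/-- For ξ with denominator b, a nonzero qξ - p is at least 1/b in size, whereas convergents satisfy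
q|qξ - p| ≤ 1 with q > b. -/
theorem IsCF.irrational {ξ : ℝ} {a : ℤ} {d : ℕ → ℕ} {r : ℕ → ℝ} (h : IsCF ξ a d r) :
    Irrational ξ := by
  rintro ⟨x, rfl⟩
  obtain ⟨k, hk⟩ := exists_nat_gt (x.den : ℝ)
  have hden : (0 : ℝ) < x.den := by exact_mod_cast x.den_pos
  have h0 : (0 : ℝ) < cfDen d (k + 1) := by exact_mod_cast h.den_pos k
  have h1 : (k : ℝ) ≤ cfDen d (k + 1) := by exact_mod_cast h.den_ge k
  have hm := h.diff_mul k
  have hv : 1 ≤ cfValue d r k := by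
    have h2 : (1 : ℝ) ≤ d k := by exact_mod_cast h.one_le k
    have := h.pos (k + 1)
    have := h.cfLeft_nonneg k
    rw [cfValue]; linarith
  rw [abs_mul, abs_of_pos h0] at hm
  set D := |(cfDen d (k + 1) : ℝ) * (x : ℝ) - cfNum a d (k + 1)| with hD
  have hD0 : 0 ≤ D := abs_nonneg _
  have h2 : cfDen d (k + 1) * D ≤ 1 := by
    have := mul_le_mul_of_nonneg_left hv (mul_nonneg h0.le hD0)
    linarith
  have hx : (x : ℝ) = x.num / x.den := by exact_mod_cast (Rat.num_div_den x).symm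
  have hint : ((cfDen d (k + 1) * x.num - cfNum a d (k + 1) * x.den : ℤ) : ℝ) =
      x.den * (cfDen d (k + 1) * (x : ℝ) - cfNum a d (k + 1)) := by
    push_cast; rw [hx]; field_simp
  have hne : cfDen d (k + 1) * x.num - cfNum a d (k + 1) * x.den ≠ 0 := by
    intro h3
    rw [h3, Int.cast_zero] at hint
    exact mul_ne_zero hden.ne' (h.diff_ne_zero (k + 1)) hint.symm
  have h3 : (1 : ℝ) ≤ |((cfDen d (k + 1) * x.num - cfNum a d (k + 1) * x.den : ℤ) : ℝ)| := by
    exact_mod_cast Int.one_le_abs hne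
  rw [hint, abs_mul, abs_of_pos hden, ← hD] at h3
  have hDpos : 0 < D := by
    by_contra hn
    have : D = 0 := le_antisymm (not_lt.1 hn) hD0
    rw [this] at h3; linarith
  have h4 : x.den * D < k * D := mul_lt_mul_of_pos_right hk hDpos
  have h5 : k * D ≤ cfDen d (k + 1) * D := mul_le_mul_of_nonneg_right h1 hD0
  linarith

/-! ### Block maps and values near 3. -/

/-- The map `u ↦ [0; 1, 1 + u]`. -/
noncomputable def onesMap (u : ℝ) : ℝ := (1 + u) / (2 + u)

/-- The map `u ↦ [0; 2, 2 + u]`. -/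
noncomputable def twosMap (u : ℝ) : ℝ := (2 + u) / (5 + 2 * u)

/-- The map `u ↦ [0; 1, …, 1, 2, 2 + u]` with `2 k` digits `1`. -/
noncomputable def runMap (k : ℕ) (u : ℝ) : ℝ := onesMap^[k] (twosMap u)

/-- The value `2 + u + [0; 2 + v]`. -/
noncomputable def pairValue (u v : ℝ) : ℝ := 2 + u + 1 / (2 + v)

theorem onesMap_mem {u : ℝ} (hu : u ∈ Icc (0 : ℝ) 1) : onesMap u ∈ Icc (1 / 2 : ℝ) 1 := by
  obtain ⟨h0, h1⟩ := hu
  rw [onesMap]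
  constructor
  · rw [le_div_iff₀ (by linarith)]; linarith
  · rw [div_le_iff₀ (by linarith)]; linarith

theorem onesMap_iterate_mem {u : ℝ} (hu : u ∈ Icc (0 : ℝ) 1) (k : ℕ) :
    onesMap^[k] u ∈ Icc (0 : ℝ) 1 := by
  induction k with
  | zero => exact hu
  | succ k ih =>
    rw [Function.iterate_succ_apply']
    have := onesMap_mem ih
    exact ⟨by linarith [this.1], this.2⟩

theorem twosMap_mem {u : ℝ} (hu : u ∈ Icc (0 : ℝ) 1) : twosMap u ∈ Icc (2 / 5 : ℝ) (3 / 7) := by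
  obtain ⟨h0, h1⟩ := hu
  rw [twosMap]
  constructor
  · rw [le_div_iff₀ (by linarith)]; linarith
  · rw [div_le_iff₀ (by linarith)]; linarith

theorem twosMap_mem_unit {u : ℝ} (hu : u ∈ Icc (0 : ℝ) 1) : twosMap u ∈ Icc (0 : ℝ) 1 := by
  have := twosMap_mem hu
  exact ⟨by linarith [this.1], by linarith [this.2]⟩

theorem runMap_mem {u : ℝ} (hu : u ∈ Icc (0 : ℝ) 1) (k : ℕ) : runMap k u ∈ Icc (0 : ℝ) 1 :=
  onesMap_iterate_mem (twosMap_mem_unit hu) k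

/-- The difference quotient of `onesMap` is 1 / ((2 + x)(2 + y)), which lies between 1/9 and 1/4. -/
theorem onesMap_iterate_sub {u v : ℝ} (hu : u ∈ Icc (0 : ℝ) 1) (hv : v ∈ Icc (0 : ℝ) 1) (k : ℕ) :
    ∃ c, (1 / 9 : ℝ) ^ k ≤ c ∧ c ≤ (1 / 4 : ℝ) ^ k ∧
      onesMap^[k] u - onesMap^[k] v = c * (u - v) := by
  induction k with
  | zero => exact ⟨1, by simp, by simp, by simp⟩
  | succ k ih =>
    obtain ⟨c, hc1, hc2, hc3⟩ := ih
    have h1 := onesMap_iterate_mem hu k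
    have h2 := onesMap_iterate_mem hv k
    rw [Function.iterate_succ_apply', Function.iterate_succ_apply']
    set x := onesMap^[k] u
    set y := onesMap^[k] v
    obtain ⟨x0, x1⟩ := h1
    obtain ⟨y0, y1⟩ := h2
    have hp : 4 ≤ (2 + x) * (2 + y) := by nlinarith
    have hq : (2 + x) * (2 + y) ≤ 9 := by nlinarith
    have hc0 : 0 ≤ c := le_trans (by positivity) hc1
    refine ⟨c * (1 / ((2 + x) * (2 + y))), ?_, ?_, ?_⟩
    · rw [pow_succ]
      refine mul_le_mul hc1 ?_ (by norm_num) hc0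
      exact one_div_le_one_div_of_le (by linarith) hq
    · rw [pow_succ]
      refine mul_le_mul hc2 ?_ (by positivity) (by positivity)
      exact one_div_le_one_div_of_le (by norm_num) hp
    · rw [mul_right_comm, ← hc3, onesMap, onesMap]
      field_simp
      ring

/-- The constant 1/81 is deliberately weak: being a power of 1/9, it combines with
`onesMap_iterate_sub`. -/
theorem twosMap_sub {u v : ℝ} (hu : u ∈ Icc (0 : ℝ) 1) (hv : v ∈ Icc (0 : ℝ) 1) :
    ∃ c, (1 / 81 : ℝ) ≤ c ∧ c ≤ 1 / 4 ∧ twosMap u - twosMap v = c * (u - v) := by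
  obtain ⟨x0, x1⟩ := hu
  obtain ⟨y0, y1⟩ := hv
  have hp : 4 ≤ (5 + 2 * u) * (5 + 2 * v) := by nlinarith
  have hq : (5 + 2 * u) * (5 + 2 * v) ≤ 81 := by nlinarith
  refine ⟨1 / ((5 + 2 * u) * (5 + 2 * v)), one_div_le_one_div_of_le (by linarith) hq,
    one_div_le_one_div_of_le (by norm_num) hp, ?_⟩
  rw [twosMap, twosMap]
  field_simp
  ring

theorem runMap_abs_sub {u v : ℝ} (hu : u ∈ Icc (0 : ℝ) 1) (hv : v ∈ Icc (0 : ℝ) 1) (k : ℕ) :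
    (1 / 9 : ℝ) ^ (k + 2) * |u - v| ≤ |runMap k u - runMap k v| ∧
      |runMap k u - runMap k v| ≤ 1 / 4 * |u - v| := by
  obtain ⟨c, hc1, hc2, hc3⟩ := onesMap_iterate_sub (twosMap_mem_unit hu) (twosMap_mem_unit hv) k
  obtain ⟨b, hb1, hb2, hb3⟩ := twosMap_sub hu hv
  have hc0 : 0 ≤ c := le_trans (by positivity) hc1
  have hc4 : c ≤ 1 := hc2.trans (pow_le_one₀ (by norm_num) (by norm_num))
  have hb0 : 0 ≤ b := by linarith
  rw [runMap, runMap, hc3, hb3, ← mul_assoc, abs_mul, abs_of_nonneg (mul_nonneg hc0 hb0)]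
  constructor
  · refine mul_le_mul_of_nonneg_right ?_ (abs_nonneg _)
    rw [pow_add]
    exact mul_le_mul hc1 (by linarith) (by norm_num) hc0
  · refine mul_le_mul_of_nonneg_right ?_ (abs_nonneg _)
    calc c * b ≤ 1 * (1 / 4) := mul_le_mul hc4 hb2 hb0 (by norm_num)
      _ = 1 / 4 := by norm_num

/-- After removing k common applications of `onesMap`, a point at most 3/7 remains against a point
at least 1/2. -/
theorem runMap_succ_abs_sub {u v : ℝ} (hu : u ∈ Icc (0 : ℝ) 1) (hv : v ∈ Icc (0 : ℝ) 1) (k : ℕ) :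
    (1 / 9 : ℝ) ^ (k + 2) ≤ |runMap k u - runMap (k + 1) v| := by
  have hg := twosMap_mem_unit hv
  have h1 := onesMap_mem hg
  obtain ⟨c, hc1, hc2, hc3⟩ := onesMap_iterate_sub (twosMap_mem_unit hu)
    (v := onesMap (twosMap v)) ⟨by linarith [h1.1], h1.2⟩ k
  have h2 := twosMap_mem hu
  have hc0 : 0 ≤ c := le_trans (by positivity) hc1
  rw [runMap, runMap, Function.iterate_succ_apply, hc3, abs_mul, abs_of_nonneg hc0, pow_add]
  refine mul_le_mul hc1 ?_ (by norm_num) hc0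
  rw [abs_sub_comm]
  refine le_trans ?_ (le_abs_self _)
  linarith [h1.1, h2.2]

theorem runMap_orbit_close {X : ℕ → ℕ} {u v : ℕ → ℝ} (j : ℕ)
    (hu : ∀ l ≤ j, u l ∈ Icc (0 : ℝ) 1) (hv : ∀ l ≤ j, v l ∈ Icc (0 : ℝ) 1)
    (hu' : ∀ l < j, u l = runMap (X l) (u (l + 1)))
    (hv' : ∀ l < j, v l = runMap (X l) (v (l + 1))) : |u 0 - v 0| ≤ (1 / 4 : ℝ) ^ j := by
  have key : ∀ m ≤ j, |u 0 - v 0| ≤ (1 / 4 : ℝ) ^ m * |u m - v m| := by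
    intro m
    induction m with
    | zero => simp
    | succ m ih =>
      intro hm
      refine (ih (by omega)).trans ?_
      rw [pow_succ, mul_assoc, hu' m (by omega), hv' m (by omega)]
      exact mul_le_mul_of_nonneg_left
        (runMap_abs_sub (hu _ hm) (hv _ hm) _).2 (by positivity)
  refine (key j le_rfl).trans (mul_le_of_le_one_right (by positivity) ?_)
  have h1 := hu j le_rfl
  have h2 := hv j le_rfl
  rw [abs_le]; constructor <;> linarith [h1.1, h1.2, h2.1, h2.2]

theorem pairValue_abs_sub {u v u' v' : ℝ} (hv : 0 ≤ v) (hv' : 0 ≤ v') :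
    |1 / (2 + v) - 1 / (2 + v')| ≤ 1 / 4 * |v - v'| ∧
      |pairValue u v - pairValue u' v'| ≤ |u - u'| + |v - v'| := by
  have e : 1 / (2 + v) - 1 / (2 + v') = (v' - v) / ((2 + v) * (2 + v')) := by
    field_simp; ring
  have h1 : |1 / (2 + v) - 1 / (2 + v')| ≤ 1 / 4 * |v - v'| := by
    rw [e, abs_div, abs_sub_comm, abs_of_pos (a := (2 + v) * (2 + v')) (by positivity),
      div_le_iff₀ (by positivity)]
    have : 4 ≤ (2 + v) * (2 + v') := by nlinarith
    nlinarith [abs_nonneg (v - v')]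
  refine ⟨h1, ?_⟩
  have : pairValue u v - pairValue u' v' = (u - u') + (1 / (2 + v) - 1 / (2 + v')) := by
    rw [pairValue, pairValue]; ring
  rw [this]
  refine (abs_add_le _ _).trans ?_
  linarith [abs_nonneg (v - v')]

theorem exists_golden : ∃ σ : ℝ, 3 / 5 < σ ∧ σ < 31 / 50 ∧ σ * σ + σ = 1 := by
  refine ⟨(√5 - 1) / 2, ?_, ?_, ?_⟩
  · have : (11 / 5 : ℝ) < √5 := Real.lt_sqrt_of_sq_lt (by norm_num)
    linarith
  · have : √5 < (56 / 25 : ℝ) := (Real.sqrt_lt' (by norm_num)).2 (by norm_num)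
    linarith
  · have := Real.mul_self_sqrt (show (0 : ℝ) ≤ 5 by norm_num)
    linarith

/-- The distance of `[0; 1, …, 1, 2, 2 + u]` to the golden fixed point of `onesMap`. -/
theorem golden_sub_runMap {σ : ℝ} (h1 : 3 / 5 < σ) (h2 : σ < 31 / 50) (h3 : σ * σ + σ = 1)
    {u : ℝ} (hu : u ∈ Icc (0 : ℝ) 1) (k : ℕ) :
    17 / 100 * (1 / 9 : ℝ) ^ k ≤ σ - runMap k u ∧ σ - runMap k u ≤ 22 / 100 * (1 / 4 : ℝ) ^ k := by
  have hfix : onesMap^[k] σ = σ := by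
    apply Function.iterate_fixed
    rw [onesMap, div_eq_iff (by linarith)]; linarith
  obtain ⟨c, hc1, hc2, hc3⟩ := onesMap_iterate_sub (u := σ) ⟨by linarith, by linarith⟩
    (twosMap_mem_unit hu) k
  rw [hfix] at hc3
  -- Since `twosMap u` lies in [2/5, 3/7], its distance to σ is between 3/5 - 3/7 > 17/100 and 31/50
  -- - 2/5 = 22/100.
  have hg := twosMap_mem hu
  have hc0 : 0 ≤ c := le_trans (by positivity) hc1
  rw [runMap, hc3]
  constructor
  · rw [mul_comm]
    exact mul_le_mul hc1 (by linarith [hg.2]) (by norm_num) hc0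
  · rw [mul_comm (22 / 100 : ℝ)]
    exact mul_le_mul hc2 (by linarith [hg.1]) (by linarith [hg.2]) (by positivity)

/-- Near the golden point the first argument can only lower the value below 3 and the second can
only raise it. A run n in second place raises it by order at least 9⁻ⁿ. Runs from 2n + 3 on have an
effect of at most order 16⁻ⁿ/64, which is smaller. -/
theorem pairValue_bounds {n : ℕ} {u v : ℝ} (hu : u ∈ Icc (0 : ℝ) 1) (hv : v ∈ Icc (0 : ℝ) 1) :
    (∀ k m, 2 * n + 3 ≤ m →
      pairValue (runMap k u) (runMap m v) ≤ 3 + 1 / 1000 * (1 / 9 : ℝ) ^ n) ∧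
    (∀ k, 2 * n + 3 ≤ k →
      3 + 1 / 100 * (1 / 9 : ℝ) ^ n ≤ pairValue (runMap k u) (runMap n v)) ∧
    (∀ k, pairValue (runMap k u) (runMap n v) < 3 + (1 / 4 : ℝ) ^ n) := by
  obtain ⟨σ, s1, s2, s3⟩ := exists_golden
  have hz : (0 : ℝ) < (1 / 9 : ℝ) ^ n := by positivity
  have hsmall : ∀ k, 2 * n + 3 ≤ k → (1 / 4 : ℝ) ^ k ≤ 1 / 64 * (1 / 9 : ℝ) ^ n := by
    intro k hk
    calc (1 / 4 : ℝ) ^ k ≤ (1 / 4 : ℝ) ^ (2 * n + 3) :=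
          pow_le_pow_of_le_one (by norm_num) (by norm_num) hk
      _ = 1 / 64 * (1 / 16 : ℝ) ^ n := by rw [pow_add, pow_mul]; norm_num; ring
      _ ≤ 1 / 64 * (1 / 9 : ℝ) ^ n := by gcongr; norm_num
  have expand : ∀ x y : ℝ, y ∈ Icc (0 : ℝ) 1 → y ≤ σ →
      pairValue x y ≤ 3 - (σ - x) + 1 / 4 * (σ - y) ∧
      3 - (σ - x) + 1 / 9 * (σ - y) ≤ pairValue x y := by
    intro x y hy hyσ
    obtain ⟨y0, y1⟩ := hy
    -- This rests on 1 / (2 + σ) = 1 - σ, a form of σ² + σ = 1.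
    have e : 1 / (2 + y) = 1 - σ + (σ - y) * (1 / ((2 + y) * (2 + σ))) := by
      have h1 : (2 + σ) * (1 - σ) = 1 := by linarith
      have h2 : (2 + y) ≠ 0 := by linarith
      have h3 : (2 + σ) ≠ 0 := by linarith
      field_simp
      linear_combination (-(2 + y)) * h1
    have hp : 4 ≤ (2 + y) * (2 + σ) := by nlinarith
    have hq : (2 + y) * (2 + σ) ≤ 9 := by nlinarith
    have b1 : 1 / ((2 + y) * (2 + σ)) ≤ 1 / 4 := one_div_le_one_div_of_le (by norm_num) hp
    have b2 : 1 / 9 ≤ 1 / ((2 + y) * (2 + σ)) := one_div_le_one_div_of_le (by linarith) hq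
    have m1 := mul_le_mul_of_nonneg_left b1 (sub_nonneg.2 hyσ)
    have m2 := mul_le_mul_of_nonneg_left b2 (sub_nonneg.2 hyσ)
    rw [pairValue, e]
    constructor <;> linarith
  have hpos : ∀ k, (0 : ℝ) < (1 / 9 : ℝ) ^ k := fun k => by positivity
  refine ⟨fun k m hm => ?_, fun k hk => ?_, fun k => ?_⟩
  · have g1 := golden_sub_runMap s1 s2 s3 hu k
    have g2 := golden_sub_runMap s1 s2 s3 hv m
    have := (expand (runMap k u) (runMap m v) (runMap_mem hv m) (by linarith [hpos m])).1
    have := hsmall m hm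
    linarith [hpos k]
  · have g1 := golden_sub_runMap s1 s2 s3 hu k
    have g2 := golden_sub_runMap s1 s2 s3 hv n
    have := (expand (runMap k u) (runMap n v) (runMap_mem hv n) (by linarith [hpos n])).2
    have := hsmall k hk
    linarith [hpos k]
  · have g1 := golden_sub_runMap s1 s2 s3 hu k
    have g2 := golden_sub_runMap s1 s2 s3 hv n
    have := (expand (runMap k u) (runMap n v) (runMap_mem hv n) (by linarith [hpos n])).1
    have : (0 : ℝ) < (1 / 4 : ℝ) ^ n := by positivity
    linarith [hpos k]

/-! ### Digit sequences made of runs of ones separated by 22. -/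

/-- Starting positions of the blocks `1 … 1 2 2` with `2 K i` digits `1`. -/
def runStart (K : ℕ → ℕ) : ℕ → ℕ
  | 0 => 0
  | i + 1 => runStart K i + 2 * K i + 2

open Classical in
/-- The concatenation of the blocks `1 … 1 2 2` with `2 K i` digits `1`. -/
noncomputable def runDigits (K : ℕ → ℕ) (k : ℕ) : ℕ :=
  if ∃ i, k = runStart K i + 2 * K i ∨ k = runStart K i + 2 * K i + 1 then 2 else 1

theorem runStart_mono (K : ℕ → ℕ) : Monotone (runStart K) :=
  monotone_nat_of_le_succ fun i => by simp only [runStart]; omega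

theorem le_runStart (K : ℕ → ℕ) (i : ℕ) : i ≤ runStart K i := by
  induction i with
  | zero => simp
  | succ i ih => simp only [runStart]; omega

theorem runDigits_eq (K : ℕ → ℕ) (k : ℕ) : runDigits K k = 1 ∨ runDigits K k = 2 := by
  rw [runDigits]; split_ifs <;> simp

theorem runDigits_ones (K : ℕ → ℕ) (i j : ℕ) (hj : j < 2 * K i) :
    runDigits K (runStart K i + j) = 1 := by
  rw [runDigits, if_neg]
  rintro ⟨i', h⟩
  rcases lt_trichotomy i' i with hlt | rfl | hgt
  · have h1 := runStart_mono K (Nat.succ_le_of_lt hlt)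
    simp only [runStart] at h1
    omega
  · omega
  · have h1 := runStart_mono K (Nat.succ_le_of_lt hgt)
    simp only [runStart] at h1
    omega

theorem runDigits_first (K : ℕ → ℕ) (i : ℕ) : runDigits K (runStart K i + 2 * K i) = 2 := by
  rw [runDigits, if_pos ⟨i, Or.inl rfl⟩]

theorem runDigits_second (K : ℕ → ℕ) (i : ℕ) : runDigits K (runStart K i + 2 * K i + 1) = 2 := by
  rw [runDigits, if_pos ⟨i, Or.inr rfl⟩]

namespace IsCF

section Ones

variable {ξ : ℝ} {a : ℤ} {d : ℕ → ℕ} {r : ℕ → ℝ}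

theorem tail_ones (h : IsCF ξ a d r) (m : ℕ) : ∀ p, (∀ j < 2 * m, d (p + j) = 1) →
    r p = onesMap^[m] (r (p + 2 * m)) := by
  induction m with
  | zero => simp
  | succ m ih =>
    intro p hp
    have h1 := ih (p + 2) (fun j hj => by rw [add_assoc]; exact hp (2 + j) (by omega))
    rw [show p + 2 * (m + 1) = p + 2 + 2 * m by omega, Function.iterate_succ_apply', ← h1]
    have e0 := h.tail_mul p
    have e1 := h.tail_mul (p + 1)
    rw [show d p = 1 from hp 0 (by omega)] at e0
    rw [hp 1 (by omega)] at e1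
    push_cast at e0 e1
    have p2 := h.pos (p + 2)
    have q1 : r (p + 1) = 1 / (1 + r (p + 2)) := eq_one_div_of_mul_eq_one_left e1
    have q0 : r p = 1 / (1 + r (p + 1)) := eq_one_div_of_mul_eq_one_left e0
    rw [q0, q1, onesMap]
    field_simp
    ring

theorem cfLeft_ones (h : IsCF ξ a d r) (p m : ℕ) (hp : ∀ j < 2 * m, d (p + j) = 1) :
    cfLeft d (p + 2 * m) = onesMap^[m] (cfLeft d p) := by
  induction m with
  | zero => simp
  | succ m ih =>
    have h1 := ih (fun j hj => hp j (by omega))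
    rw [show p + 2 * (m + 1) = p + 2 * m + 1 + 1 by omega, Function.iterate_succ_apply', ← h1]
    have d0 := hp (2 * m) (by omega)
    have d1 := hp (2 * m + 1) (by omega)
    rw [← add_assoc] at d1
    have l0 := h.cfLeft_nonneg (p + 2 * m)
    simp only [cfLeft, d0, d1, onesMap]
    push_cast
    field_simp
    ring

theorem tail_mem (h : IsCF ξ a d r) (k : ℕ) : r k ∈ Icc (0 : ℝ) 1 := ⟨(h.pos k).le, (h.lt_one k).le⟩

theorem cfLeft_mem (h : IsCF ξ a d r) (k : ℕ) : cfLeft d k ∈ Icc (0 : ℝ) 1 :=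
  ⟨h.cfLeft_nonneg k, h.cfLeft_le_one k⟩

end Ones

variable {ξ : ℝ} {a : ℤ} {K : ℕ → ℕ} {r : ℕ → ℝ}

theorem tail_runStart (h : IsCF ξ a (runDigits K) r) (i : ℕ) :
    r (runStart K i) = runMap (K i) (r (runStart K (i + 1))) := by
  rw [h.tail_ones (K i) _ (fun j hj => runDigits_ones K i j hj), runMap]
  congr 1
  have e0 := h.tail_mul (runStart K i + 2 * K i)
  have e1 := h.tail_mul (runStart K i + 2 * K i + 1)
  rw [runDigits_first] at e0
  rw [runDigits_second] at e1
  push_cast at e0 e1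
  have p2 := h.pos (runStart K i + 2 * K i + 1 + 1)
  have q1 := eq_one_div_of_mul_eq_one_left e1
  have q0 := eq_one_div_of_mul_eq_one_left e0
  rw [q0, q1, twosMap]
  simp only [runStart]
  field_simp
  ring

/-- The runs and the pair 22 are palindromes, so the same maps act leftwards as in `tail_runStart`.
-/
theorem cfLeft_runStart (h : IsCF ξ a (runDigits K) r) (i : ℕ) :
    cfLeft (runDigits K) (runStart K (i + 1) + 2 * K (i + 1)) =
      runMap (K (i + 1)) (cfLeft (runDigits K) (runStart K i + 2 * K i)) := by
  rw [h.cfLeft_ones _ _ (fun j hj => runDigits_ones K (i + 1) j hj), runMap]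
  congr 1
  have l0 := h.cfLeft_nonneg (runStart K i + 2 * K i)
  rw [show runStart K (i + 1) = runStart K i + 2 * K i + 1 + 1 from rfl]
  simp only [cfLeft, runDigits_first, runDigits_second, twosMap]
  push_cast
  field_simp
  ring

theorem value_first (h : IsCF ξ a (runDigits K) r) (i : ℕ) :
    cfValue (runDigits K) r (runStart K i + 2 * K i) =
      pairValue (cfLeft (runDigits K) (runStart K i + 2 * K i)) (r (runStart K (i + 1))) := by
  have e1 := h.tail_mul (runStart K i + 2 * K i + 1)
  rw [runDigits_second] at e1
  push_cast at e1
  have q1 := eq_one_div_of_mul_eq_one_left e1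
  rw [cfValue, runDigits_first, q1, pairValue]
  simp only [runStart]
  push_cast
  ring

end IsCF

theorem cfValue_runDigits_second (K : ℕ → ℕ) (r : ℕ → ℝ) (i : ℕ) :
    cfValue (runDigits K) r (runStart K i + 2 * K i + 1) =
      pairValue (r (runStart K (i + 1))) (cfLeft (runDigits K) (runStart K i + 2 * K i)) := by
  rw [cfValue, runDigits_second, pairValue]
  simp only [runStart, cfLeft, runDigits_first]
  push_cast
  ring

/-! ### Points of the spectrum just above 3. -/

/-- The runs `X (j - 1), …, X 0, n, X 0, …, X (j - 1)` for `j = 0, 1, …`, concatenated; the `j`-th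
chunk occupies the indices from `j ^ 2` to `j ^ 2 + 2 j`. -/
def markedRuns (n : ℕ) (X : ℕ → ℕ) (i : ℕ) : ℕ :=
  if i - i.sqrt * i.sqrt = i.sqrt then n
  else if i.sqrt < i - i.sqrt * i.sqrt then X (i - i.sqrt * i.sqrt - i.sqrt - 1)
  else X (i.sqrt - 1 - (i - i.sqrt * i.sqrt))

section MarkedRuns

variable (n : ℕ) (X : ℕ → ℕ)

theorem sqrt_chunk {j t : ℕ} (ht : t ≤ 2 * j) : (j * j + t).sqrt = j :=
  Nat.sqrt_add_eq j (by omega)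

theorem markedRuns_center (j : ℕ) : markedRuns n X (j * j + j) = n := by
  rw [markedRuns, sqrt_chunk (by omega), if_pos (by omega)]

theorem markedRuns_right {j l : ℕ} (hl : l < j) : markedRuns n X (j * j + j + 1 + l) = X l := by
  rw [show j * j + j + 1 + l = j * j + (j + 1 + l) by omega, markedRuns,
    sqrt_chunk (by omega), if_neg (by omega), if_pos (by omega)]
  congr 1; omega

theorem markedRuns_left {j l : ℕ} (hl : l < j) : markedRuns n X (j * j + (j - 1 - l)) = X l := by
  rw [markedRuns, sqrt_chunk (by omega), if_neg (by omega), if_neg (by omega)]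
  congr 1; omega

theorem markedRuns_cases (i : ℕ) : (∃ j, i = j * j + j) ∨ ∃ l, markedRuns n X i = X l := by
  rw [markedRuns]
  split_ifs with h1 h2
  · left
    refine ⟨i.sqrt, ?_⟩
    have := Nat.sqrt_le i
    omega
  · exact Or.inr ⟨_, rfl⟩
  · exact Or.inr ⟨_, rfl⟩

end MarkedRuns

/-- For runs `X l ≥ 2 n + 3` with tails `Y l`, the number with runs `markedRuns n X` has its best
constant determined by the tail `Y 0`. -/
theorem pairValue_mem_lagrangeSpectrum {n : ℕ} {X : ℕ → ℕ} (hX : ∀ l, 2 * n + 3 ≤ X l)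
    {Y : ℕ → ℝ} (hY : ∀ l, Y l ∈ Icc (0 : ℝ) 1) (hYX : ∀ l, Y l = runMap (X l) (Y (l + 1))) :
    pairValue (Y 0) (runMap n (Y 0)) ∈ lagrangeSpectrum := by
  set K := markedRuns n X with hKdef
  obtain ⟨r, h⟩ := exists_isCF_of_digits (runDigits K) (runDigits_eq K)
  set R : ℕ → ℝ := fun i => r (runStart K i) with hR
  set L : ℕ → ℝ := fun i => cfLeft (runDigits K) (runStart K i + 2 * K i) with hL
  have hRm : ∀ i, R i ∈ Icc (0 : ℝ) 1 := fun i => h.tail_mem _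
  have hLm : ∀ i, L i ∈ Icc (0 : ℝ) 1 := fun i => h.cfLeft_mem _
  have hRs : ∀ i, R i = runMap (K i) (R (i + 1)) := h.tail_runStart
  have hLs : ∀ i, L (i + 1) = runMap (K (i + 1)) (L i) := h.cfLeft_runStart
  set t := pairValue (Y 0) (runMap n (Y 0)) with ht
  have hpos : (0 : ℝ) < (1 / 9 : ℝ) ^ n := by positivity
  -- This exceeds the bound 3 + 9⁻ⁿ/1000 at pairs whose second argument comes from a long run, and
  -- the bound 3 at digits 1. Only values next to marked runs can affect the limit superior.
  have ht3 : 3 + 1 / 100 * (1 / 9 : ℝ) ^ n ≤ t := by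
    have := (pairValue_bounds (n := n) (hY 1) (hY 0)).2.1 (X 0) (hX 0)
    rwa [← hYX 0] at this
  have hclose : ∀ u ∈ Icc (0 : ℝ) 1, ∀ v ∈ Icc (0 : ℝ) 1, ∀ j : ℕ, |u - Y 0| ≤ (1 / 4 : ℝ) ^ j →
      |v - Y 0| ≤ (1 / 4 : ℝ) ^ j → |pairValue u (runMap n v) - t| ≤ 2 * (1 / 4 : ℝ) ^ j := by
    intro u hu v hv j h1 h2
    have h3 := (pairValue_abs_sub (u := u) (u' := Y 0) (runMap_mem hv n).1
      (runMap_mem (hY 0) n).1).2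
    have h4 := (runMap_abs_sub hv (hY 0) n).2
    have := abs_nonneg (v - Y 0)
    linarith
  have hRc : ∀ j, |R (j * j + j + 1) - Y 0| ≤ (1 / 4 : ℝ) ^ j := by
    intro j
    refine runMap_orbit_close (X := X) (u := fun l => R (j * j + j + 1 + l)) (v := Y) j
      (fun l _ => hRm _) (fun l _ => hY l) (fun l hl => ?_) (fun l _ => hYX l)
    rw [hRs, hKdef, markedRuns_right n X hl]; rfl
  have hLc : ∀ j, 1 ≤ j → |L (j * j + j - 1) - Y 0| ≤ (1 / 4 : ℝ) ^ j := by
    intro j hj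
    have hjj : 1 ≤ j * j := Nat.mul_pos hj hj
    refine runMap_orbit_close (X := X) (u := fun l => L (j * j + j - 1 - l)) (v := Y) j
      (fun l _ => hLm _) (fun l _ => hY l) (fun l hl => ?_) (fun l _ => hYX l)
    have h1 := hLs (j * j + j - 1 - (l + 1))
    rw [show j * j + j - 1 - (l + 1) + 1 = j * j + (j - 1 - l) by omega, hKdef,
      markedRuns_left n X hl] at h1
    rw [← h1]
    congr 1; omega
  -- The mirrored chunk makes the 2 facing the marked run from the left and the one facing it from
  -- the right have the same limiting value t.
  have hfirst : ∀ j, 1 ≤ j → |pairValue (L (j * j + j - 1)) (R (j * j + j)) - t| ≤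
      2 * (1 / 4 : ℝ) ^ j := by
    intro j hj
    rw [hRs, hKdef, markedRuns_center]
    exact hclose _ (hLm _) _ (hRm _) j (hLc j hj) (hRc j)
  have hsecond : ∀ j, 1 ≤ j → |pairValue (R (j * j + j + 1)) (L (j * j + j)) - t| ≤
      2 * (1 / 4 : ℝ) ^ j := by
    intro j hj
    have h1 := hLs (j * j + j - 1)
    rw [show j * j + j - 1 + 1 = j * j + j by omega, hKdef, markedRuns_center] at h1
    rw [h1]
    exact hclose _ (hRm _) _ (hLm _) j (hRc j) (hLc j hj)
  have hsmall : ∀ ε > (0 : ℝ), ∃ J : ℕ, 1 ≤ J ∧ ∀ j, J ≤ j → 2 * (1 / 4 : ℝ) ^ j ≤ ε := by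
    intro ε hε
    obtain ⟨J, hJ⟩ := exists_pow_lt_of_lt_one (half_pos hε) (by norm_num : (1 / 4 : ℝ) < 1)
    refine ⟨J + 1, by omega, fun j hj => ?_⟩
    have := pow_le_pow_of_le_one (by norm_num : (0 : ℝ) ≤ 1 / 4) (by norm_num)
      (show J ≤ j by omega)
    linarith
  refine ⟨r 0, h.irrational, h.bestConstant_eq h.irrational.ne_zero (by linarith) ?_ ?_⟩
  · intro ε hε
    obtain ⟨J, hJ1, hJ⟩ := hsmall ε hε
    have hmark : ∀ i j, J * J + J < i → i = j * j + j → J ≤ j := by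
      intro i j hi hij
      by_contra hlt
      have : j * j ≤ J * J := Nat.mul_le_mul (by omega) (by omega)
      omega
    refine eventually_atTop.2 ⟨runStart K (J * J + J + 1), fun k hk => ?_⟩
    by_cases hd : ∃ i, k = runStart K i + 2 * K i ∨ k = runStart K i + 2 * K i + 1
    · obtain ⟨i, hi⟩ := hd
      have hi1 : J * J + J < i := by
        by_contra hlt
        have h1 := runStart_mono K (show i + 1 ≤ J * J + J + 1 by omega)
        simp only [runStart] at h1 hk
        omega
      obtain ⟨m, rfl⟩ : ∃ m, i = m + 1 := ⟨i - 1, by omega⟩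
      rcases hi with rfl | rfl
      · rw [h.value_first]
        change pairValue (L (m + 1)) (R (m + 2)) ≤ _
        -- Only the run in the second argument needs inspection, since a marked run in the first
        -- argument lowers the value.
        rcases markedRuns_cases n X (m + 2) with ⟨j, hj⟩ | ⟨l, hl⟩
        · have hJj := hmark _ j (by omega) hj
          have h1 := hfirst j (by omega)
          rw [← hj, show m + 2 - 1 = m + 1 by omega] at h1
          have := (abs_le.1 h1).2
          have := hJ j hJj
          linarith
        · rw [hLs, hRs]
          have := (pairValue_bounds (n := n) (hLm m) (hRm (m + 2 + 1))).1 (K (m + 1)) (K (m + 2))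
            (by rw [hKdef, hl]; exact hX l)
          linarith
      · rw [cfValue_runDigits_second]
        change pairValue (R (m + 2)) (L (m + 1)) ≤ _
        rcases markedRuns_cases n X (m + 1) with ⟨j, hj⟩ | ⟨l, hl⟩
        · have hJj := hmark _ j (by omega) hj
          have h1 := hsecond j (by omega)
          rw [← hj] at h1
          have := (abs_le.1 h1).2
          have := hJ j hJj
          rw [show m + 1 + 1 = m + 2 by omega] at *
          linarith
        · rw [hLs, hRs]
          have := (pairValue_bounds (n := n) (hRm (m + 2 + 1)) (hLm m)).1 (K (m + 2)) (K (m + 1))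
            (by rw [hKdef, hl]; exact hX l)
          linarith
    · have hd1 : runDigits K k = 1 := by rw [runDigits, if_neg hd]
      rw [cfValue, hd1]
      have := h.lt_one (k + 1)
      have := h.cfLeft_le_one k
      push_cast
      linarith
  · intro ε hε
    obtain ⟨J, hJ1, hJ⟩ := hsmall ε hε
    refine frequently_atTop.2 fun M => ?_
    obtain ⟨j, hj⟩ : ∃ j, j = J + M + 1 := ⟨_, rfl⟩
    refine ⟨runStart K (j * j + j - 1) + 2 * K (j * j + j - 1), ?_, ?_⟩
    · have := le_runStart K (j * j + j - 1)
      have : 1 ≤ j * j := Nat.mul_pos (by omega) (by omega)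
      omega
    · rw [h.value_first]
      have h1 := hfirst j (by omega)
      rw [show j * j + j = j * j + j - 1 + 1 by omega, Nat.add_sub_cancel] at h1
      have := (abs_le.1 h1).1
      have := hJ j (by omega)
      change _ ≤ pairValue (L (j * j + j - 1)) (R (j * j + j - 1 + 1))
      linarith

/-! ### Binary coding and the lower bound for the dimension. -/

/-- The orbit of the doubling map of the circle `[0, 1)`. -/
noncomputable def doublingOrbit (y : ℝ) : ℕ → ℝ
  | 0 => y
  | l + 1 => 2 * doublingOrbit y l - (if 1 / 2 ≤ doublingOrbit y l then 1 else 0)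

/-- Runs coding the binary expansion of `y`: `N` for the digit `0` and `N + 1` for the digit `1`. -/
noncomputable def binaryRuns (N : ℕ) (y : ℝ) (l : ℕ) : ℕ :=
  N + (if 1 / 2 ≤ doublingOrbit y l then 1 else 0)

theorem doublingOrbit_mem {y : ℝ} (hy : y ∈ Ico (0 : ℝ) 1) (l : ℕ) :
    doublingOrbit y l ∈ Ico (0 : ℝ) 1 := by
  induction l with
  | zero => exact hy
  | succ l ih =>
    simp only [doublingOrbit]
    obtain ⟨h0, h1⟩ := ih
    split_ifs with h <;> constructor <;> linarith

theorem abs_sub_le_of_binaryRuns_eq {N : ℕ} {y y' : ℝ} (hy : y ∈ Ico (0 : ℝ) 1)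
    (hy' : y' ∈ Ico (0 : ℝ) 1) (j : ℕ) (h : ∀ l < j, binaryRuns N y l = binaryRuns N y' l) :
    |y - y'| ≤ (1 / 2 : ℝ) ^ j := by
  have key : ∀ m ≤ j, y - y' = (1 / 2 : ℝ) ^ m * (doublingOrbit y m - doublingOrbit y' m) := by
    intro m
    induction m with
    | zero => simp [doublingOrbit]
    | succ m ih =>
      intro hm
      have h1 := h m (by omega)
      simp only [binaryRuns] at h1
      have h2 : (if 1 / 2 ≤ doublingOrbit y m then (1 : ℝ) else 0) =
          if 1 / 2 ≤ doublingOrbit y' m then 1 else 0 := by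
        split_ifs at h1 ⊢ <;> first | rfl | omega
      rw [ih (by omega), pow_succ]
      simp only [doublingOrbit]
      rw [h2]; ring
  rw [key j le_rfl, abs_mul, abs_of_pos (by positivity : (0 : ℝ) < (1 / 2) ^ j)]
  refine mul_le_of_le_one_right (by positivity) ?_
  have h1 := doublingOrbit_mem hy j
  have h2 := doublingOrbit_mem hy' j
  rw [abs_le]; constructor <;> linarith [h1.1, h1.2, h2.1, h2.2]

theorem exists_first_binaryRuns_ne (N : ℕ) {y y' : ℝ} (hy : y ∈ Ico (0 : ℝ) 1)
    (hy' : y' ∈ Ico (0 : ℝ) 1) (hne : y ≠ y') :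
    ∃ j, (∀ l < j, binaryRuns N y l = binaryRuns N y' l) ∧
      binaryRuns N y j ≠ binaryRuns N y' j := by
  have hex : ∃ j, binaryRuns N y j ≠ binaryRuns N y' j := by
    by_contra! hall
    have hpos := abs_pos.2 (sub_ne_zero.2 hne)
    obtain ⟨j, hj⟩ := exists_pow_lt_of_lt_one hpos (by norm_num : (1 / 2 : ℝ) < 1)
    have := abs_sub_le_of_binaryRuns_eq (N := N) hy hy' j (fun l _ => hall l)
    linarith
  classical
  refine ⟨Nat.find hex, fun l hl => ?_, Nat.find_spec hex⟩
  have := Nat.find_min hex hl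
  push Not at this
  exact this

/-- Each common run k ≤ N + 1 shrinks distances by at most 9^(k + 2) ≤ 9^(N + 3), and the first
differing run leaves a gap of at least 9^(-(N + 2)). -/
theorem abs_sub_tail_ge {N : ℕ} {X X' : ℕ → ℕ} {Y Y' : ℕ → ℝ}
    (hX : ∀ l, X l = N ∨ X l = N + 1) (hX' : ∀ l, X' l = N ∨ X' l = N + 1)
    (hY : ∀ l, Y l ∈ Icc (0 : ℝ) 1) (hY' : ∀ l, Y' l ∈ Icc (0 : ℝ) 1)
    (hYX : ∀ l, Y l = runMap (X l) (Y (l + 1)))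
    (hYX' : ∀ l, Y' l = runMap (X' l) (Y' (l + 1))) (j : ℕ) (heq : ∀ l < j, X l = X' l)
    (hne : X j ≠ X' j) : ((1 / 9 : ℝ) ^ (N + 3)) ^ (j + 1) ≤ |Y 0 - Y' 0| := by
  have key : ∀ m ≤ j, ((1 / 9 : ℝ) ^ (N + 3)) ^ m * |Y m - Y' m| ≤ |Y 0 - Y' 0| := by
    intro m
    induction m with
    | zero => simp
    | succ m ih =>
      intro hm
      refine le_trans ?_ (ih (by omega))
      rw [pow_succ, mul_assoc]
      refine mul_le_mul_of_nonneg_left ?_ (by positivity)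
      rw [hYX m, hYX' m, heq m (by omega)]
      refine le_trans ?_ (runMap_abs_sub (hY _) (hY' _) _).1
      refine mul_le_mul_of_nonneg_right ?_ (abs_nonneg _)
      exact pow_le_pow_of_le_one (by norm_num) (by norm_num)
        (by rcases hX' m with h | h <;> omega)
  refine le_trans ?_ (key j le_rfl)
  rw [pow_succ]
  refine mul_le_mul_of_nonneg_left ?_ (by positivity)
  have hpow : (1 / 9 : ℝ) ^ (N + 3) ≤ (1 / 9 : ℝ) ^ (N + 2) :=
    pow_le_pow_of_le_one (by norm_num) (by norm_num) (by omega)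
  refine hpow.trans ?_
  rw [hYX j, hYX' j]
  rcases hX j with h1 | h1 <;> rcases hX' j with h2 | h2
  · omega
  · rw [h1, h2]; exact runMap_succ_abs_sub (hY _) (hY' _) N
  · rw [h1, h2, abs_sub_comm]; exact runMap_succ_abs_sub (hY' _) (hY _) N
  · omega

/-- The first argument contributes |u - v| and the second at most a sixteenth of it; 1/9 is a
convenient weaker constant. -/
theorem abs_sub_pairValue_ge (n : ℕ) {u v : ℝ} (hu : u ∈ Icc (0 : ℝ) 1) (hv : v ∈ Icc (0 : ℝ) 1) :
    1 / 9 * |u - v| ≤ |pairValue u (runMap n u) - pairValue v (runMap n v)| := by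
  have h1 := (pairValue_abs_sub (u := 0) (u' := 0) (runMap_mem hu n).1 (runMap_mem hv n).1).1
  have h2 := (runMap_abs_sub hu hv n).2
  have h3 := abs_nonneg (u - v)
  have h4 : u - v = (pairValue u (runMap n u) - pairValue v (runMap n v)) -
      (1 / (2 + runMap n u) - 1 / (2 + runMap n v)) := by
    simp only [pairValue]; ring
  have h5 := abs_sub (pairValue u (runMap n u) - pairValue v (runMap n v))
    (1 / (2 + runMap n u) - 1 / (2 + runMap n v))
  rw [← h4] at h5
  linarith

theorem exists_runMap_tail (X : ℕ → ℕ) : ∃ Y : ℕ → ℝ, ∀ l, Y l ∈ Icc (0 : ℝ) 1 ∧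
    Y l = runMap (X l) (Y (l + 1)) :=
  exists_backward_orbit (fun l => runMap (X l)) zero_le_one (by norm_num : (0 : ℝ) ≤ 1 / 4)
    (by norm_num) (fun _ _ hx => runMap_mem hx _) (fun _ _ hx _ hy => (runMap_abs_sub hx hy _).2)

/-- The inverse of t is ρ-Hölder from the image onto [0, 1), so 1 ≤ dim(image) / ρ. -/
theorem le_dimH_image_of_abs_sub_le {t : ℝ → ℝ} {C ρ : ℝ≥0} (hρ : 0 < ρ)
    (h : ∀ y ∈ Ico (0 : ℝ) 1, ∀ y' ∈ Ico (0 : ℝ) 1, |y - y'| ≤ C * |t y - t y'| ^ (ρ : ℝ)) :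
    (ρ : ENNReal) ≤ dimH (t '' Ico (0 : ℝ) 1) := by
  have hinj : InjOn t (Ico (0 : ℝ) 1) := by
    intro y hy y' hy' heq
    have h1 := h y hy y' hy'
    rw [heq, sub_self, abs_zero, Real.zero_rpow (by exact_mod_cast hρ.ne'), mul_zero] at h1
    exact sub_eq_zero.1 (abs_nonpos_iff.1 h1)
  have hleft : LeftInvOn (Function.invFunOn t (Ico (0 : ℝ) 1)) t (Ico (0 : ℝ) 1) :=
    hinj.leftInvOn_invFunOn
  have hH : HolderOnWith C ρ (Function.invFunOn t (Ico (0 : ℝ) 1)) (t '' Ico (0 : ℝ) 1) := by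
    rintro _ ⟨y, hy, rfl⟩ _ ⟨y', hy', rfl⟩
    rw [hleft hy, hleft hy', edist_dist, edist_dist, Real.dist_eq, Real.dist_eq,
      ENNReal.ofReal_rpow_of_nonneg (abs_nonneg _) ρ.coe_nonneg,
      ← ENNReal.ofReal_coe_nnreal (p := C), ← ENNReal.ofReal_mul C.coe_nonneg]
    exact ENNReal.ofReal_le_ofReal (h y hy y' hy')
  have h1 := hH.dimH_image_le hρ
  rw [hleft.image_image] at h1
  have h2 : dimH (Ico (0 : ℝ) 1) = 1 := by
    rw [Real.dimH_of_nonempty_interior]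
    · simp
    · rw [interior_Ico]; exact ⟨1 / 2, by norm_num, by norm_num⟩
  rw [h2, ENNReal.le_div_iff_mul_le (Or.inl (by exact_mod_cast hρ.ne'))
    (Or.inl ENNReal.coe_ne_top), one_mul] at h1
  exact h1

/-- A lower bound for the dimension of the Lagrange spectrum just above `3`. -/
theorem le_lagrangeDim (n : ℕ) :
    Real.log 2 / ((2 * n + 7) * Real.log 9) ≤ lagrangeDim (3 + (1 / 4 : ℝ) ^ n) := by
  set N := 2 * n + 3 with hN
  choose Y hY using fun y => exists_runMap_tail (binaryRuns N y)
  set t : ℝ → ℝ := fun y => pairValue (Y y 0) (runMap n (Y y 0)) with ht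
  have hXN : ∀ y l, binaryRuns N y l = N ∨ binaryRuns N y l = N + 1 := by
    intro y l
    rw [binaryRuns]; split_ifs <;> simp
  have hsub : t '' Ico (0 : ℝ) 1 ⊆ lagrangeSpectrum ∩ Iio (3 + (1 / 4 : ℝ) ^ n) := by
    rintro _ ⟨y, -, rfl⟩
    refine ⟨pairValue_mem_lagrangeSpectrum (X := binaryRuns N y)
      (fun l => by rcases hXN y l with h | h <;> omega)
      (fun l => (hY y l).1) (fun l => (hY y l).2), ?_⟩
    have := (pairValue_bounds (n := n) (hY y 1).1 (hY y 0).1).2.2 (binaryRuns N y 0)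
    rwa [← (hY y 0).2] at this
  have hlog2 : 0 < Real.log 2 := Real.log_pos (by norm_num)
  have hlog9 : 0 < Real.log 9 := Real.log_pos (by norm_num)
  have hρ0 : 0 < Real.log 2 / ((2 * n + 7) * Real.log 9) := by positivity
  obtain ⟨ρ, hρ⟩ : ∃ ρ : ℝ≥0, (ρ : ℝ) = Real.log 2 / ((2 * n + 7) * Real.log 9) :=
    ⟨⟨_, hρ0.le⟩, rfl⟩
  -- The exponent is the one for which a factor 9^(-(N + 4)) per run, with N + 4 = 2n + 7, matches a
  -- factor 1/2 per binary digit.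
  have hscale : ((1 / 9 : ℝ) ^ (N + 4)) ^ (ρ : ℝ) = 1 / 2 := by
    rw [← Real.rpow_natCast, ← Real.rpow_mul (by norm_num), hρ,
      Real.rpow_def_of_pos (by norm_num)]
    have e : Real.log (1 / 9) * (((N + 4 : ℕ) : ℝ) * (Real.log 2 / ((2 * n + 7) * Real.log 9))) =
        Real.log (1 / 2) := by
      rw [one_div, one_div, Real.log_inv, Real.log_inv, hN]
      push_cast
      field_simp
      ring
    rw [e, Real.exp_log (by norm_num)]
  have hhol : ∀ y ∈ Ico (0 : ℝ) 1, ∀ y' ∈ Ico (0 : ℝ) 1,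
      |y - y'| ≤ ((2 : ℝ≥0) : ℝ) * |t y - t y'| ^ (ρ : ℝ) := by
    intro y hy y' hy'
    by_cases hne : y = y'
    · subst hne
      simp only [sub_self, abs_zero]
      positivity
    obtain ⟨j, heq, hj⟩ := exists_first_binaryRuns_ne N hy hy' hne
    have h1 := abs_sub_le_of_binaryRuns_eq hy hy' j heq
    have h2 := abs_sub_tail_ge (hXN y) (hXN y') (fun l => (hY y l).1) (fun l => (hY y' l).1)
      (fun l => (hY y l).2) (fun l => (hY y' l).2) j heq hj
    have h3 := abs_sub_pairValue_ge n (hY y 0).1 (hY y' 0).1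
    -- The extra factor 1/9 from `abs_sub_pairValue_ge` is absorbed by raising the exponent from N +
    -- 3 to N + 4.
    have h4 : ((1 / 9 : ℝ) ^ (N + 4)) ^ (j + 1) ≤ |t y - t y'| := by
      refine le_trans ?_ h3
      refine le_trans ?_ (mul_le_mul_of_nonneg_left h2 (by norm_num))
      rw [show N + 4 = N + 3 + 1 by omega, pow_succ (1 / 9 : ℝ) (N + 3), mul_pow, mul_comm]
      refine mul_le_mul_of_nonneg_right ?_ (by positivity)
      exact pow_le_of_le_one (by norm_num) (by norm_num) (by omega)
    have h5 := Real.rpow_le_rpow (by positivity) h4 ρ.coe_nonneg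
    rw [← Real.rpow_pow_comm (by positivity), hscale, pow_succ] at h5
    push_cast
    linarith
  have hdim := (le_dimH_image_of_abs_sub_le (by exact_mod_cast hρ ▸ hρ0) hhol).trans (dimH_mono hsub)
  have hfin : dimH (lagrangeSpectrum ∩ Iio (3 + (1 / 4 : ℝ) ^ n)) ≠ ⊤ :=
    ne_top_of_le_ne_top ENNReal.one_ne_top (dimH_real_le_one _)
  rw [← hρ, lagrangeDim]
  exact ENNReal.toReal_mono hfin hdim

/-! ### Failure of Hölder continuity at 3. -/

theorem mainTheorem6 (α : ℝ≥0) (hα : 0 < α) :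
    ¬ ∃ C : ℝ≥0, HolderWith C α lagrangeDim := by
  rintro ⟨C, hC⟩
  have hlog2 : 0 < Real.log 2 := Real.log_pos (by norm_num)
  have hlog9 : 0 < Real.log 9 := Real.log_pos (by norm_num)
  set q : ℝ := (1 / 4 : ℝ) ^ (α : ℝ) with hq
  have hq0 : 0 < q := by positivity
  have hq1 : q < 1 := Real.rpow_lt_one (by norm_num) (by norm_num) (by exact_mod_cast hα)
  -- Compare the points 3 + 4⁻ⁿ and 3. The right-hand side is C(2n + 7)qⁿ with q = 4^(-α) < 1, which
  -- tends to 0.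
  have hbound : ∀ n : ℕ, Real.log 2 / Real.log 9 ≤ C * (2 * (n ^ 1 * q ^ n) + 7 * q ^ n) := by
    intro n
    have h1 := hC.dist_le (3 + (1 / 4 : ℝ) ^ n) 3
    have h2 := le_lagrangeDim n
    have h3 : dist (3 + (1 / 4 : ℝ) ^ n) 3 = (1 / 4 : ℝ) ^ n := by
      rw [Real.dist_eq, add_sub_cancel_left, abs_of_pos (by positivity)]
    rw [lagrangeDim_three, h3, Real.dist_eq, sub_zero,
      ← Real.rpow_pow_comm (by norm_num), ← hq] at h1
    have h4 := h2.trans ((le_abs_self _).trans h1)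
    rw [div_le_iff₀ (by positivity)] at h4
    rw [div_le_iff₀ hlog9]
    linarith
  have hlim : Tendsto (fun n : ℕ => (C : ℝ) * (2 * ((n : ℝ) ^ 1 * q ^ n) + 7 * q ^ n)) atTop
      (nhds ((C : ℝ) * (2 * 0 + 7 * 0))) := by
    have habs : |q| < 1 := by rwa [abs_of_pos hq0]
    exact (((tendsto_pow_const_mul_const_pow_of_abs_lt_one 1 habs).const_mul 2).add
      ((tendsto_pow_atTop_nhds_zero_of_lt_one hq0.le hq1).const_mul 7)).const_mul _
  have h0 := ge_of_tendsto' hlim hbound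
  have : 0 < Real.log 2 / Real.log 9 := by positivity
  simp only [mul_zero, add_zero] at h0
  linarith
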